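/- Let $\mathbb D=\{z\in\mathbb C:|z|<1\}$ and let $\mathcal A$ be the class of analytic functions $f$ on $\mathbb D$ with $f(0)=f'(0)-1=0$. For $\beta<1$ and real $\alpha,\gamma$ let $W_\beta(\alpha,\gamma)$ be the class of all $f\in\mathcal A$ for which there is $\phi\in\mathbb R$ with $$\mathrm{Re}\Big(e^{i\phi}\Big((1-\alpha+2\gamma)\frac{f(z)}{z}+(\alpha-2\gamma)f'(z)+\gamma z f''(z)-\beta\Big)\Big)>0,\qquad z\in\mathbb D,$$ where $f(z)/z$ has the value $1$ at $z=0$. For $0\le\xi\le1$ let $M(\xi)$ be the Pascu class of all $F\in\mathcal A$ such that $K(z)=\xi zF'(z)+(1-\xi)F(z)$ is starlike, i.e. $\mathrm{Re}\,(zK'(z)/K(z))>0$ in $\mathbb D$ (with value $1$ of the quotient at $z=0$). For an integrable weight $\lambda\ge0$ on $(0,1)$ with $\int_0^1\lambda(t)\,dt=1$ and for $\rho<1$ put, for $f\in\mathcal A$, $$\mathcal V_\lambda(f)(z)=\Big(z\int_0^1\lambda(t)\frac{1-\rho tz}{1-tz}\,dt\Big)*f(z),$$ where $*$ is the Hadamard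 product $\big(\sum a_nz^n\big)*\big(\sum b_nz^n\big)=\sum a_nb_nz^n$. Let $\alpha\in\mathbb R$, $\gamma>0$, and let $\mu\ge1$, $\nu\ge0$ satisfy $\mu+\nu=\alpha-\gamma$ and $\mu\nu=\gamma$ (so $\nu>0$). Let $0\le\xi\le1$, $\rho<1$, $\beta<1$, and $$g(t)=2\sum_{n=0}^\infty\frac{(n+1)(-1)^nt^n}{(1+\mu n)(1+\nu n)}-1,\qquad q(t)=\sum_{n=0}^\infty\frac{(n+1)^2(-1)^nt^n}{(1+\mu n)(1+\nu n)},\qquad 0\le t<1.$$ In each of the following three cases assume that $\beta$ satisfies, for the weight $\lambda$ in question, $$\frac{1}{2(1-\beta)(1-\rho)}=\int_0^1\lambda(t)\Big[(1-\xi)\frac{1-g(t)}{2}+\xi\,(1-q(t))\Big]dt .$$ Then $\mathcal V_\lambda(f)\in M(\xi)$ for every $f\in W_\beta(\alpha,\gamma)$ in each of these cases. 1. (Hypergeometric type weight.) $\mu>1$, $\nu>1$, $\lambda(t)=k\,t^{B-1}(1-t)^{C-A-B}\varphi(1-t)$ with real $A,B,C$, where $\varphi$ is twice continuously differentiable on $(0,1)$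 with $\varphi>0$, $\varphi'\ge0$, $\varphi''\ge0$ there, $k$ is a constant such that $\lambda\ge0$ is integrable with $\int_0^1\lambda(t)\,dt=1$, and $$B<\min\Big(2+\frac1\mu,\;C-A-1\Big).$$ 2. (The $(a,b)$ weight.) $a>-1$, $b>-1$, $\lambda(t)=(a+1)(b+1)\,\dfrac{t^a(1-t^{b-a})}{b-a}$ if $b\ne a$ and $\lambda(t)=(a+1)^2t^a\log(1/t)$ if $b=a$, and one of the following holds: (i) $b>a$, $-1<a<0$ and $b+a-1<\frac1\mu<b-1$; (ii) $b<a$, $-1<b<0$ and $b+a-1<\frac1\mu<a-1$; (iii) $b=a<0$ and $\frac1\mu>b-1$. 3. (Komatu weight.) $-1<c<0$, $p>2$ and $\lambda(t)=\dfrac{(1+c)^p}{\Gamma(p)}\,t^c\Big(\log\dfrac1t\Big)^{p-1}$. -/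

import Mathlib

open Set MeasureTheory
open scoped Real

noncomputable section

namespace PascuClass

/-- The open unit disc of the complex plane. -/
def unitDisc : Set ℂ := Metric.ball (0 : ℂ) 1

/-- The class of analytic functions on the unit disc with `f 0 = 0` and `f' 0 = 1`. -/
def classA : Set (ℂ → ℂ) :=
  {f | DifferentiableOn ℂ f unitDisc ∧ f 0 = 0 ∧ deriv f 0 = 1}

/-- The class `W_β(α, γ)`. Since `f 0 = 0`, the divided slope `dslope f 0 z` is `f z / z` for
`z ≠ 0`, and it has the value `f' 0` at the removable singularity `z = 0`. -/
def classW (β α γ : ℝ) : Set (ℂ → ℂ) :=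
  {f | f ∈ classA ∧ ∃ φ : ℝ, ∀ z ∈ unitDisc,
    0 < (Complex.exp (Complex.I * φ) *
      ((1 - α + 2 * γ) * dslope f 0 z + (α - 2 * γ) * deriv f z
        + γ * z * deriv (deriv f) z - β)).re}

/-- Starlike functions of order `σ`: normalized analytic functions with `Re (z f' / f) > σ` in the
disc. At `z = 0` the quotient has the value `1`; at a zero `z ≠ 0` of `f` the condition fails for
`0 ≤ σ`, because then the quotient is `0` in Lean. -/
def starlike (σ : ℝ) : Set (ℂ → ℂ) :=
  {f | f ∈ classA ∧ ∀ z ∈ unitDisc, z ≠ 0 → σ < (z * deriv f z / f z).re}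

/-- The Pascu class `M(ξ, σ)`: those `F` for which `ξ z F' + (1 - ξ) F` is starlike of
order `σ`. -/
def pascuOrder (ξ σ : ℝ) : Set (ℂ → ℂ) :=
  {F | F ∈ classA ∧ (fun z : ℂ => (ξ : ℂ) * z * deriv F z + (1 - (ξ : ℂ)) * F z) ∈ starlike σ}

/-- The Pascu class `M(ξ) = M(ξ, 0)`. -/
def pascu (ξ : ℝ) : Set (ℂ → ℂ) := pascuOrder ξ 0

/-- The `n`-th Taylor coefficient at the origin. -/
def taylorCoeff (f : ℂ → ℂ) (n : ℕ) : ℂ := iteratedDeriv n f 0 / (n.factorial : ℂ)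

/-- The Hadamard product (convolution) of two functions analytic in the unit disc. -/
def hadamard (f g : ℂ → ℂ) (z : ℂ) : ℂ :=
  ∑' n : ℕ, taylorCoeff f n * taylorCoeff g n * z ^ n

/-- The generalized integral operator with weight `lam` and parameter `ρ`: the convolution of
`z ∫₀¹ lam t (1 - ρ t z) / (1 - t z) dt` with `f`. -/
def genOp (lam : ℝ → ℝ) (ρ : ℝ) (f : ℂ → ℂ) : ℂ → ℂ :=
  hadamard
    (fun z : ℂ => z * ∫ t in (0 : ℝ)..1, (lam t : ℂ) * ((1 - ρ * t * z) / (1 - t * z))) f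

/-- The auxiliary function `g`, given by its power series. -/
def gFun (μ ν t : ℝ) : ℝ :=
  2 * (∑' n : ℕ, ((n : ℝ) + 1) * (-1) ^ n * t ^ n / ((1 + μ * n) * (1 + ν * n))) - 1

/-- The auxiliary function `q`, given by its power series. -/
def qFun (μ ν t : ℝ) : ℝ :=
  ∑' n : ℕ, ((n : ℝ) + 1) ^ 2 * (-1) ^ n * t ^ n / ((1 + μ * n) * (1 + ν * n))

/-- The equation that ties `β` to `ρ`, `ξ` and the weight. -/
def BetaCondition (lam : ℝ → ℝ) (μ ν ξ ρ β : ℝ) : Prop :=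
  1 / (2 * (1 - β) * (1 - ρ)) =
    ∫ t in (0 : ℝ)..1, lam t * ((1 - ξ) * ((1 - gFun μ ν t) / 2) + ξ * (1 - qFun μ ν t))

/-- The standing requirement on a weight: non-negative, integrable and of total mass one. -/
structure IsWeight (lam : ℝ → ℝ) : Prop where
  nonneg : ∀ t ∈ Ioo (0 : ℝ) 1, 0 ≤ lam t
  integrable : IntervalIntegrable lam volume 0 1
  integral_eq_one : ∫ t in (0 : ℝ)..1, lam t = 1

/-- The factors `φ` allowed in the hypergeometric type weight: twice continuously differentiable
and positive on `(0, 1)` with non-negative first and second derivatives there. -/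
structure IsHypergeometricFactor (φ : ℝ → ℝ) : Prop where
  contDiffOn : ContDiffOn ℝ 2 φ (Ioo 0 1)
  pos : ∀ x ∈ Ioo (0 : ℝ) 1, 0 < φ x
  deriv_nonneg : ∀ x ∈ Ioo (0 : ℝ) 1, 0 ≤ deriv φ x
  deriv_deriv_nonneg : ∀ x ∈ Ioo (0 : ℝ) 1, 0 ≤ deriv (deriv φ) x

/-- The hypergeometric type weight `k t^(B-1) (1-t)^(C-A-B) φ(1-t)`. -/
def hypergeometricWeight (k A B C : ℝ) (φ : ℝ → ℝ) (t : ℝ) : ℝ :=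
  k * t ^ (B - 1) * (1 - t) ^ (C - A - B) * φ (1 - t)

open Classical in
/-- The `(a, b)` weight. -/
def abWeight (a b t : ℝ) : ℝ :=
  if b = a then (a + 1) ^ 2 * t ^ a * Real.log (1 / t)
  else (a + 1) * (b + 1) * (t ^ a * (1 - t ^ (b - a)) / (b - a))

/-- The Komatu weight. -/
def komatuWeight (c p t : ℝ) : ℝ :=
  (1 + c) ^ p / Real.Gamma p * t ^ c * Real.log (1 / t) ^ (p - 1)

end PascuClass

end

/-! Duality reduces starlikeness to one real inequality. Let `K` be `ξ z F' + (1 - ξ) F` for `F` the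
transform of `f`. By a Cayley transform, `z K' / K` has positive real part as soon as every `(1 -
x)/2 * K/z + (1 + x)/2 * K'`, `‖x‖ ≤ 1`, lies in one open half-plane bounded by a line through 0
(`re_div_pos_of_forall`). Comparing Taylor coefficients, `1 - β` times this function is the Hadamard
product of the expression defining `W_β` with `P = 1 - c + c ∫ λ(t) S[h_x](tz) dt`, where `c = (1 -
β)(1 - ρ)`, `h_x` has coefficients `1 + n (1 + x)/2`, and `S` multiplies the `n`-th coefficient by
`(1 + ξ n) / ((1 + μ n)(1 + ν n))`. Convolution with a function of real part at least 1/2 preserves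
such half-planes (`HasDiscSeries.re_mul_hadamard_pos`), so `Re P ≥ 1/2` suffices. By the equation
for `β` this says that `Re ∫ λ S[h_x](tz) dt` is at least `∫ λ S[1/(1+t)²] dt`
(`integral_pascuAvg_le_re`).

The multiplier `S` is a positive combination of averages over dilations `t ↦ t σ^p`. Pointwise, `Re
h_x - 1/(1+v)²` is bounded below by an explicit `kernelGap`, which changes sign at most once in `v`,
from plus to minus, and whose integral against `1 - v²` over every `[0, r]` is non-negative
(`integral_kernelGap_nonneg`). A Chebyshev argument transfers this to every weight with `λ(t)/(1 -
t²)` decreasing, which covers the `(a, b)` and Komatu weights. For the hypergeometric weight only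
`λ(t) t^(-1 - 1/μ)` is known to decrease; there the average over `σ^μ` is used first, and an
integration by parts leads back to a weight of the earlier kind. -/

namespace PascuClass

/-! ### The pointwise gap and its sign pattern -/

/-- The quadratic `|1 - v ζ|²` for `|ζ| = 1`, `Re ζ = c`. -/
def kernelDen (c v : ℝ) : ℝ := 1 - 2 * v * c + v ^ 2

/-- The polynomial that carries the sign of `kernelGap`. -/
def gapPoly (c v : ℝ) : ℝ :=
  3 - 4 * (1 + c) * v + (8 * c - 2) * v ^ 2 + 4 * (c - 1) * v ^ 3 - v ^ 4

/-- A lower bound for `Re (h (v ζ) / (v ζ)) - 1 / (1 + v)²` over the extremal starlike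
functions `h`. -/
noncomputable def kernelGap (c v : ℝ) : ℝ :=
  (1 + c) * v * gapPoly c v / (2 * kernelDen c v ^ 2 * (1 + v) ^ 2)

lemma kernelDen_pos {c v : ℝ} (hc : |c| ≤ 1) (hv : 0 ≤ v) (hv1 : v < 1) : 0 < kernelDen c v := by
  obtain ⟨h1, h2⟩ := abs_le.mp hc
  unfold kernelDen
  nlinarith [mul_nonneg hv (sub_nonneg.mpr h2)]

lemma gapPoly_antitoneOn {c : ℝ} (hc : |c| ≤ 1) : AntitoneOn (gapPoly c) (Icc 0 1) := by
  obtain ⟨h1, h2⟩ := abs_le.mp hc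
  have hd : ∀ v, HasDerivAt (gapPoly c)
      (-4 * (1 + c) + (8 * c - 2) * (2 * v) + 4 * (c - 1) * (3 * v ^ 2) - 4 * v ^ 3) v := by
    intro v
    unfold gapPoly
    have := ((((hasDerivAt_id v).const_mul (4 * (1 + c))).const_sub 3).add
      ((hasDerivAt_pow 2 v).const_mul (8 * c - 2))).add
      ((hasDerivAt_pow 3 v).const_mul (4 * (c - 1))) |>.sub (hasDerivAt_pow 4 v)
    refine this.congr_deriv ?_
    norm_num
  refine antitoneOn_of_deriv_nonpos (convex_Icc 0 1)
    (fun v _ => (hd v).continuousAt.continuousWithinAt)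
    (fun v _ => (hd v).differentiableAt.differentiableWithinAt) fun v hv => ?_
  rw [interior_Icc] at hv
  rw [(hd v).deriv]
  -- The derivative is affine in `c`, hence interpolates its values at `c = 1` and `c = -1`; it
  -- equals `-2` times the sum of the terms in `e1` and `e2`.
  have e1 : 0 ≤ (1 + c) * ((1 - v) ^ 2 * (v + 2)) :=
    mul_nonneg (by linarith) (mul_nonneg (sq_nonneg _) (by linarith [hv.1]))
  have e2 : 0 ≤ (1 - c) * (5 * v + 6 * v ^ 2 + v ^ 3) := by
    have := hv.1
    exact mul_nonneg (by linarith) (by positivity)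
  nlinarith

/-- By monotonicity only `v = 1/4` matters, where the polynomial is affine in `c`. The uniform
threshold 1/4 serves as `δ` in `integral_antitone_mul_nonneg`. -/
lemma gapPoly_pos_of_le {c v : ℝ} (hc : |c| ≤ 1) (hv : 0 ≤ v) (hv1 : v ≤ 1 / 4) :
    0 < gapPoly c v := by
  have h := gapPoly_antitoneOn hc ⟨hv, by linarith⟩ (by norm_num : (1 / 4 : ℝ) ∈ Icc (0 : ℝ) 1) hv1
  obtain ⟨h1, h2⟩ := abs_le.mp hc
  refine lt_of_lt_of_le ?_ h
  unfold gapPoly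
  linarith

lemma kernelGap_nonneg_of_le {c v : ℝ} (hc : |c| ≤ 1) (hv : 0 ≤ v) (hv1 : v ≤ 1 / 4) :
    0 ≤ kernelGap c v := by
  have := gapPoly_pos_of_le hc hv hv1
  have : 0 ≤ 1 + c := by linarith [(abs_le.mp hc).1]
  unfold kernelGap
  positivity

/-- All factors of the gap other than `gapPoly` are non-negative and `gapPoly` decreases, so the
sign changes at most once, from plus to minus. -/
lemma kernelGap_nonpos_of_neg {c v w : ℝ} (hc : |c| ≤ 1) (hv : 0 ≤ v) (hvw : v ≤ w) (hw : w ≤ 1)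
    (h : kernelGap c v < 0) : kernelGap c w ≤ 0 := by
  have h1 : 0 ≤ 1 + c := by linarith [(abs_le.mp hc).1]
  have hN : gapPoly c v < 0 := by
    by_contra! hN
    exact absurd h (not_lt.mpr (by unfold kernelGap; positivity))
  have hN' : gapPoly c w ≤ 0 :=
    (gapPoly_antitoneOn hc ⟨hv, hvw.trans hw⟩ ⟨hv.trans hvw, hw⟩ hvw).trans hN.le
  unfold kernelGap
  exact div_nonpos_of_nonpos_of_nonneg
    (mul_nonpos_of_nonneg_of_nonpos (mul_nonneg h1 (hv.trans hvw)) hN') (by positivity)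

lemma kernelGap_eq {c v : ℝ} (hc : |c| ≤ 1) (hv : 0 ≤ v) (hv1 : v < 1) :
    kernelGap c v = (1 - v * (1 + c) / 2) / kernelDen c v
      - v ^ 2 * (1 - c ^ 2) / kernelDen c v ^ 2 - 1 / (1 + v) ^ 2 := by
  have hd := (kernelDen_pos hc hv hv1).ne'
  have hv' : 1 + v ≠ 0 := by linarith
  unfold kernelGap
  field_simp
  unfold kernelDen gapPoly
  ring

lemma continuousOn_kernelGap {c : ℝ} (hc : |c| ≤ 1) : ContinuousOn (kernelGap c) (Ico 0 1) := by
  unfold kernelGap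
  refine ContinuousOn.div ?_ ?_ fun v hv => ?_
  · unfold gapPoly; fun_prop
  · unfold kernelDen; fun_prop
  · have := kernelDen_pos hc hv.1 hv.2
    have := hv.1
    positivity

/-- Pointwise comparison with the extremal starlike functions. -/
lemma kernelGap_le_re {x ζ : ℂ} (hx : ‖x‖ ≤ 1) (hζ : ‖ζ‖ = 1) {v : ℝ} (hv : 0 ≤ v) (hv1 : v < 1) :
    kernelGap ζ.re v ≤
      ((1 + (x - 1) / 2 * (v * ζ)) / (1 - v * ζ) ^ 2).re - 1 / (1 + v) ^ 2 := by
  have hc : |ζ.re| ≤ 1 := (Complex.abs_re_le_norm ζ).trans hζ.le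
  have hd := kernelDen_pos hc hv hv1
  have hsq : ζ.re ^ 2 + ζ.im ^ 2 = 1 := by
    have := Complex.sq_norm ζ
    rw [hζ, Complex.normSq_apply] at this
    nlinarith
  have hn : Complex.normSq (1 - v * ζ) = kernelDen ζ.re v := by
    rw [Complex.normSq_apply]
    simp only [Complex.sub_re, Complex.one_re, Complex.mul_re, Complex.ofReal_re,
      Complex.ofReal_im, zero_mul, sub_zero, Complex.sub_im, Complex.one_im, Complex.mul_im,
      add_zero, zero_sub, kernelDen]
    linear_combination v ^ 2 * hsq
  -- The parameter `x` enters only through `x v ζ / 2` in the numerator, which is estimated by its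
  -- modulus; the rest is computed exactly.
  have hB : -(v / (2 * kernelDen ζ.re v)) ≤ ((x / 2 * (v * ζ)) / (1 - v * ζ) ^ 2).re := by
    refine neg_le_of_abs_le ((Complex.abs_re_le_norm _).trans ?_)
    rw [norm_div, norm_pow, ← Complex.normSq_eq_norm_sq, hn, norm_mul, norm_mul, norm_div, hζ,
      Complex.norm_real, Real.norm_of_nonneg hv]
    rw [div_le_div_iff₀ hd (by positivity)]
    have : ‖x‖ * (v * kernelDen ζ.re v) ≤ 1 * (v * kernelDen ζ.re v) :=
      mul_le_mul_of_nonneg_right hx (by positivity)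
    norm_num
    nlinarith
  have hA : ((1 - (v * ζ) / 2) / (1 - v * ζ) ^ 2 : ℂ).re
      = (1 - v * ζ.re / 2) / kernelDen ζ.re v
        - v ^ 2 * (1 - ζ.re ^ 2) / kernelDen ζ.re v ^ 2 := by
    rw [Complex.div_re, map_pow, hn]
    simp only [pow_two, Complex.sub_re, Complex.one_re, Complex.mul_re, Complex.ofReal_re,
      Complex.ofReal_im, zero_mul, sub_zero, Complex.sub_im, Complex.one_im, Complex.mul_im,
      add_zero, zero_sub, Complex.div_ofNat_re, Complex.div_ofNat_im]
    field_simp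
    have him : ζ.im ^ 2 = 1 - ζ.re ^ 2 := by linarith
    unfold kernelDen
    ring_nf
    simp only [him]
    ring
  have hsplit : (1 + (x - 1) / 2 * (v * ζ)) / (1 - v * ζ) ^ 2
      = (1 - (v * ζ) / 2) / (1 - v * ζ) ^ 2 + (x / 2 * (v * ζ)) / (1 - v * ζ) ^ 2 := by ring
  rw [hsplit, Complex.add_re, hA, kernelGap_eq hc hv hv1]
  have : (1 - v * (1 + ζ.re) / 2) / kernelDen ζ.re v
      = (1 - v * ζ.re / 2) / kernelDen ζ.re v - v / (2 * kernelDen ζ.re v) := by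
    field_simp
    ring
  linarith

/-! ### The integral of the gap against `1 - v²` -/

lemma hasDerivAt_log_one_add {r : ℝ} (hr : 0 ≤ r) :
    HasDerivAt (fun r => Real.log (1 + r)) (1 / (1 + r)) r := by
  simpa using ((hasDerivAt_id r).const_add 1).log (by simp; linarith)

/-- Antiderivative of the part of the gap integrand that does not depend on the angle. -/
noncomputable def gapPrim (r : ℝ) : ℝ :=
  ((1 + r) ^ 2 / 2 - 3 * (1 + r) - 2 * Real.log (1 + r) - 12 / (1 + r) + 4 / (1 + r) ^ 2) / 2
    + 4 * (r - 2 * Real.log (1 + r) - 1 / (1 + r)) + 37 / 4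

lemma hasDerivAt_gapPrim {r : ℝ} (hr : 0 ≤ r) :
    HasDerivAt gapPrim (r * (1 - r) ^ 2 * (3 + r) / (2 * (1 + r) ^ 3) + 4 * r ^ 2 / (1 + r) ^ 2)
      r := by
  have hr' : 1 + r ≠ 0 := by linarith
  have h1 : HasDerivAt (fun r : ℝ => 1 + r) 1 r := (hasDerivAt_id r).const_add 1
  have hl := hasDerivAt_log_one_add hr
  have h2 := h1.pow 2
  have hi := h1.inv hr'
  have hi2 := h2.inv (by simpa using hr')
  have := ((((((h2.div_const 2).sub (h1.const_mul 3)).sub (hl.const_mul 2)).sub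
    (hi.const_mul 12)).add (hi2.const_mul 4)).div_const 2).add
    ((((hasDerivAt_id r).sub (hl.const_mul 2)).sub hi).const_mul 4) |>.add_const (37 / 4)
  refine (this.congr_deriv ?_).congr_of_eventuallyEq (Filter.Eventually.of_forall fun s => ?_)
  · simp
    field_simp
    ring
  · simp [gapPrim, div_eq_mul_inv]

/-- This normalization fixes the additive constant 37/4. -/
lemma gapPrim_zero : gapPrim 0 = 0 := by
  simp [gapPrim]; norm_num

lemma hasDerivAt_cube_div {c r : ℝ} (hd : kernelDen c r ≠ 0) :
    HasDerivAt (fun r => r ^ 3 / kernelDen c r)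
      ((3 * r ^ 2 * kernelDen c r - r ^ 3 * (2 * r - 2 * c)) / kernelDen c r ^ 2) r := by
  have h : HasDerivAt (kernelDen c) (2 * r - 2 * c) r := by
    unfold kernelDen
    have := ((((hasDerivAt_id r).const_mul 2).mul_const c).const_sub 1).add (hasDerivAt_pow 2 r)
    refine this.congr_deriv ?_
    norm_num
    ring
  refine ((hasDerivAt_pow 3 r).div h hd).congr_deriv ?_
  norm_num

/-- The difference of the two sides has derivative of the sign of `3 - 6r - r²` on `(0, 1)`, so it
rises up to `√12 - 3` and then falls. It vanishes at 0, and at 1 it equals `25/4 - 9 log 2`, which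
is just positive. -/
lemma gapPrim_ge {r : ℝ} (hr : 0 ≤ r) (hr1 : r ≤ 1) : 2 * r ^ 3 / (1 + r) ^ 2 ≤ gapPrim r := by
  set G : ℝ → ℝ := fun r => gapPrim r - 2 * (r ^ 3 / kernelDen (-1) r) with hG
  have hk : ∀ r, kernelDen (-1) r = (1 + r) ^ 2 := fun r => by unfold kernelDen; ring
  have hd : ∀ r, 0 ≤ r → HasDerivAt G (r * (1 - r) * (3 - 6 * r - r ^ 2) / (2 * (1 + r) ^ 3)) r := by
    intro r hr
    have hr' : 1 + r ≠ 0 := by linarith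
    have := (hasDerivAt_gapPrim hr).sub
      ((hasDerivAt_cube_div (c := -1) (r := r) (by rw [hk]; positivity)).const_mul 2)
    refine this.congr_deriv ?_
    rw [hk]
    field_simp
    ring
  suffices h : 0 ≤ G r by
    have := h
    simp only [hG, hk] at this
    rw [mul_div_assoc]
    linarith
  have h0 : G 0 = 0 := by simp [hG, gapPrim_zero]
  have h1 : 0 ≤ G 1 := by
    have := Real.log_two_lt_d9
    simp only [hG, hk, gapPrim]
    norm_num
    linarith
  set r₀ : ℝ := Real.sqrt 12 - 3
  have hs : Real.sqrt 12 ^ 2 = 12 := Real.sq_sqrt (by norm_num)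
  have hs3 : 3 ≤ Real.sqrt 12 := Real.le_sqrt_of_sq_le (by norm_num)
  have hs4 : Real.sqrt 12 ≤ 4 := (Real.sqrt_le_left (by norm_num)).mpr (by norm_num)
  rcases le_total r r₀ with h | h
  · have hm : MonotoneOn G (Icc 0 r₀) := by
      refine monotoneOn_of_deriv_nonneg (convex_Icc _ _)
        (fun v hv => (hd v hv.1).continuousAt.continuousWithinAt)
        (fun v hv => ?_) fun v hv => ?_
      · rw [interior_Icc] at hv
        exact (hd v hv.1.le).differentiableAt.differentiableWithinAt
      · rw [interior_Icc] at hv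
        rw [(hd v hv.1.le).deriv]
        have e0 := hv.1
        have e1 : 0 ≤ 1 - v := by linarith [hv.2]
        have e2 : 0 ≤ 3 - 6 * v - v ^ 2 := by
          have : v + 3 ≤ Real.sqrt 12 := by linarith [hv.2]
          nlinarith
        positivity
    exact h0 ▸ hm ⟨le_rfl, hr.trans h⟩ ⟨hr, h⟩ hr
  · have hr0 : 0 ≤ r₀ := by linarith
    have hm : AntitoneOn G (Icc r₀ 1) := by
      refine antitoneOn_of_deriv_nonpos (convex_Icc _ _)
        (fun v hv => (hd v (hr0.trans hv.1)).continuousAt.continuousWithinAt)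
        (fun v hv => ?_) fun v hv => ?_
      · rw [interior_Icc] at hv
        exact (hd v (hr0.trans hv.1.le)).differentiableAt.differentiableWithinAt
      · rw [interior_Icc] at hv
        have e0 : 0 ≤ v := hr0.trans hv.1.le
        rw [(hd v e0).deriv]
        have e1 : 0 ≤ 1 - v := by linarith [hv.2]
        have e2 : 3 - 6 * v - v ^ 2 ≤ 0 := by
          have : Real.sqrt 12 ≤ v + 3 := by linarith [hv.1]
          nlinarith
        exact div_nonpos_of_nonpos_of_nonneg
          (mul_nonpos_of_nonneg_of_nonpos (by positivity) e2) (by positivity)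
    exact h1.trans (hm ⟨h, hr1⟩ ⟨h.trans hr1, le_rfl⟩ hr1)

/-- The integrand is an elementary derivative `D` plus the non-negative remainder `(1+c)² v² (1-v)³
/ ((1+v)³ kernelDen c v)`. Integrating `D` leaves a bound whose worst angle is `c = -1`, and that is
`gapPrim_ge`. -/
lemma integral_kernelGap_nonneg {c r : ℝ} (hc : |c| ≤ 1) (hr : 0 ≤ r) (hr1 : r < 1) :
    0 ≤ ∫ v in (0 : ℝ)..r, (1 - v ^ 2) * kernelGap c v := by
  obtain ⟨hc1, hc2⟩ := abs_le.mp hc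
  set D : ℝ → ℝ := fun v => (1 + c) *
    ((v * (1 - v) ^ 2 * (3 + v) / (2 * (1 + v) ^ 3) + 4 * v ^ 2 / (1 + v) ^ 2)
      - (1 - c) * ((3 * v ^ 2 * kernelDen c v - v ^ 3 * (2 * v - 2 * c)) / kernelDen c v ^ 2))
    with hD
  have hsub : uIcc 0 r ⊆ Ico (0 : ℝ) 1 := by
    rw [uIcc_of_le hr]
    exact fun v hv => ⟨hv.1, hv.2.trans_lt hr1⟩
  have hden : ContinuousOn (kernelDen c) (uIcc 0 r) := by unfold kernelDen; fun_prop
  have hDc : ContinuousOn D (uIcc 0 r) := by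
    refine continuousOn_const.mul (ContinuousOn.sub (ContinuousOn.add ?_ ?_)
      (continuousOn_const.mul ?_))
    · refine ContinuousOn.div (by fun_prop) (by fun_prop) fun v hv => ?_
      have := (hsub hv).1
      positivity
    · refine ContinuousOn.div (by fun_prop) (by fun_prop) fun v hv => ?_
      have := (hsub hv).1
      positivity
    · refine ContinuousOn.div (by fun_prop) (by fun_prop) fun v hv => ?_
      exact pow_ne_zero _ (kernelDen_pos hc (hsub hv).1 (hsub hv).2).ne'
  have hint : ∫ v in (0 : ℝ)..r, D v
      = (1 + c) * (gapPrim r - (1 - c) * (r ^ 3 / kernelDen c r)) := by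
    rw [intervalIntegral.integral_eq_sub_of_hasDerivAt
      (f := fun v => (1 + c) * (gapPrim v - (1 - c) * (v ^ 3 / kernelDen c v)))
      (fun v hv => ?_) hDc.intervalIntegrable]
    · simp [gapPrim_zero]
    · exact ((hasDerivAt_gapPrim (hsub hv).1).sub ((hasDerivAt_cube_div
        (kernelDen_pos hc (hsub hv).1 (hsub hv).2).ne').const_mul _)).const_mul _
  have hlow : 0 ≤ ∫ v in (0 : ℝ)..r, D v := by
    rw [hint]
    refine mul_nonneg (by linarith) (sub_nonneg.mpr (le_trans ?_ (gapPrim_ge hr hr1.le)))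
    rw [← mul_div_assoc, div_le_div_iff₀ (kernelDen_pos hc hr hr1) (by positivity)]
    have h3 : 0 ≤ r ^ 3 := by positivity
    -- The difference of the two sides is `(1 + c)(1 - r)²`.
    have : (1 - c) * (1 + r) ^ 2 ≤ 2 * kernelDen c r := by
      unfold kernelDen
      nlinarith [mul_nonneg (by linarith : (0 : ℝ) ≤ 1 + c) (sq_nonneg (1 - r))]
    nlinarith
  refine hlow.trans (intervalIntegral.integral_mono_on hr hDc.intervalIntegrable ?_ fun v hv => ?_)
  · exact ((by fun_prop : ContinuousOn (fun v : ℝ => 1 - v ^ 2) (uIcc 0 r)).mul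
      ((continuousOn_kernelGap hc).mono hsub)).intervalIntegrable
  · have hv0 := hv.1
    have hv1 : v < 1 := hv.2.trans_lt hr1
    have hd := kernelDen_pos hc hv0 hv1
    have key : (1 - v ^ 2) * kernelGap c v - D v
        = (1 + c) ^ 2 * (v ^ 2 * (1 - v) ^ 3 / ((1 + v) ^ 3 * kernelDen c v)) := by
      simp only [hD, kernelGap]
      field_simp
      unfold kernelDen gapPoly
      ring
    have : 0 ≤ (1 + c) ^ 2 * (v ^ 2 * (1 - v) ^ 3 / ((1 + v) ^ 3 * kernelDen c v)) := by
      have : 0 ≤ 1 - v := by linarith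
      positivity
    linarith

/-! ### From the weight `1 - t²` to general weights -/

/-- Chebyshev type inequality: an antitone weight keeps the integral of a function that changes
sign at most once, from plus to minus, non-negative. -/
lemma integral_antitone_mul_nonneg {E φ : ℝ → ℝ} {δ : ℝ} (hE : AntitoneOn E (Ioo 0 1))
    (hE0 : ∀ t ∈ Ioo (0 : ℝ) 1, 0 ≤ E t) (hδ : 0 < δ)
    (h0 : ∀ t ∈ Ioo (0 : ℝ) 1, t ≤ δ → 0 ≤ φ t)
    (hs : ∀ s ∈ Ioo (0 : ℝ) 1, ∀ t ∈ Ioo (0 : ℝ) 1, s < t → φ s < 0 → φ t ≤ 0)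
    (hφ : IntervalIntegrable φ volume 0 1) (hI : 0 ≤ ∫ t in (0 : ℝ)..1, φ t)
    (hEφ : IntervalIntegrable (fun t => E t * φ t) volume 0 1) :
    0 ≤ ∫ t in (0 : ℝ)..1, E t * φ t := by
  by_cases hall : ∀ t ∈ Ioo (0 : ℝ) 1, 0 ≤ φ t
  · have := intervalIntegral.integral_mono_on_of_le_Ioo zero_le_one
      (IntervalIntegrable.zero (μ := volume) (a := (0 : ℝ)) (b := 1) (E := ℝ)) hEφ
      fun t ht => mul_nonneg (hE0 t ht) (hall t ht)
    simpa using this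
  · push Not at hall
    set S : Set ℝ := {t | t ∈ Ioo (0 : ℝ) 1 ∧ φ t < 0} with hS
    have hSne : S.Nonempty := hall
    have hSb : BddBelow S := ⟨0, fun t ht => ht.1.1.le⟩
    -- At the sign change `u`, replacing `E t` by the constant `E u` can only lower the integrand on
    -- either side.
    set u := sInf S with hu
    have hδu : min δ 1 ≤ u := le_csInf hSne fun t ht => by
      by_contra! hlt
      exact absurd (h0 t ht.1 (hlt.le.trans (min_le_left _ _))) (not_le.mpr ht.2)
    have hu0 : 0 < u := (lt_min hδ one_pos).trans_le hδu
    have hu1 : u < 1 := (csInf_le hSb hSne.some_mem).trans_lt hSne.some_mem.1.2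
    have hpt : ∀ t ∈ Ioo (0 : ℝ) 1, E u * φ t ≤ E t * φ t := by
      intro t ht
      rcases lt_trichotomy t u with h | h | h
      · have : 0 ≤ φ t := by
          by_contra! hn
          exact absurd (csInf_le hSb (show t ∈ S from ⟨ht, hn⟩)) (not_le.mpr h)
        exact mul_le_mul_of_nonneg_right (hE ht ⟨hu0, hu1⟩ h.le) this
      · rw [h]
      · obtain ⟨s, hsS, hst⟩ := (csInf_lt_iff hSb hSne).mp h
        exact mul_le_mul_of_nonpos_right (hE ⟨hu0, hu1⟩ ht h.le) (hs s hsS.1 t ht hst hsS.2)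
    have := intervalIntegral.integral_mono_on_of_le_Ioo zero_le_one (hφ.const_mul (E u)) hEφ hpt
    rw [intervalIntegral.integral_const_mul] at this
    exact (mul_nonneg (hE0 u ⟨hu0, hu1⟩) hI).trans this

lemma continuousOn_kernelGap_mul {c r : ℝ} (hc : |c| ≤ 1) (hr : 0 ≤ r) (hr1 : r < 1) :
    ContinuousOn (fun t => kernelGap c (r * t)) (Icc 0 1) := by
  refine (continuousOn_kernelGap hc).comp (by fun_prop) fun t ht => ?_
  exact ⟨mul_nonneg hr ht.1, by nlinarith [ht.1, ht.2]⟩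

/-- The extremal inequality for weights `lam` with `lam t / (1 - t²)` decreasing. -/
lemma integral_weight_mul_kernelGap_nonneg {lam : ℝ → ℝ} (hl : ∀ t ∈ Ioo (0 : ℝ) 1, 0 ≤ lam t)
    (hi : IntervalIntegrable lam volume 0 1)
    (ha : AntitoneOn (fun t => lam t / (1 - t ^ 2)) (Ioo 0 1))
    {c r : ℝ} (hc : |c| ≤ 1) (hr : 0 ≤ r) (hr1 : r < 1) :
    0 ≤ ∫ t in (0 : ℝ)..1, lam t * kernelGap c (r * t) := by
  rcases hr.eq_or_lt with rfl | hr0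
  · simp [kernelGap]
  have hone : ∀ t ∈ Ioo (0 : ℝ) 1, 0 < 1 - t ^ 2 := fun t ht => by nlinarith [ht.1, ht.2]
  have hone' : ∀ t ∈ Ioo (0 : ℝ) 1, 0 < 1 - (r * t) ^ 2 := fun t ht => by
    have : r * t < 1 := by nlinarith [ht.1, ht.2]
    have : 0 < r * t := mul_pos hr0 ht.1
    nlinarith
  have hcont := continuousOn_kernelGap_mul hc hr hr1
  rw [← uIcc_of_le (zero_le_one' ℝ)] at hcont
  have hEφ : ∀ t ∈ Ioo (0 : ℝ) 1, lam t * kernelGap c (r * t)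
      = lam t / (1 - (r * t) ^ 2) * ((1 - (r * t) ^ 2) * kernelGap c (r * t)) := fun t ht => by
    rw [← mul_assoc, div_mul_cancel₀ _ (hone' t ht).ne']
  rw [intervalIntegral.integral_congr_Ioo_of_le zero_le_one hEφ]
  have hφc : ContinuousOn (fun t => (1 - (r * t) ^ 2) * kernelGap c (r * t)) (uIcc 0 1) :=
    ContinuousOn.mul (by fun_prop) hcont
  refine integral_antitone_mul_nonneg (δ := 1 / 4) ?_ (fun t ht => ?_) (by norm_num)
    (fun t ht h => ?_) (fun s hs t ht hst h => ?_) hφc.intervalIntegrable ?_ ?_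
  -- Since `r < 1`, the factor `(1 - t²)/(1 - (rt)²)` decreases too, so the hypothesis on `lam`
  -- passes to the rescaled denominator.
  · have hmul : AntitoneOn (fun t : ℝ => (1 - t ^ 2) / (1 - (r * t) ^ 2)) (Ioo 0 1) := by
      intro s hs t ht hst
      simp only
      rw [div_le_div_iff₀ (hone' t ht) (hone' s hs)]
      have h1 : s ^ 2 ≤ t ^ 2 := by nlinarith [hs.1]
      have h2 : r ^ 2 ≤ 1 := by nlinarith
      nlinarith [mul_nonneg (sub_nonneg.mpr h1) (sub_nonneg.mpr h2)]
    intro s hs t ht hst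
    have e : ∀ t ∈ Ioo (0 : ℝ) 1, lam t / (1 - (r * t) ^ 2)
        = lam t / (1 - t ^ 2) * ((1 - t ^ 2) / (1 - (r * t) ^ 2)) := fun t ht => by
      rw [div_mul_div_cancel₀ (hone t ht).ne']
    simp only
    rw [e s hs, e t ht]
    exact mul_le_mul (ha hs ht hst) (hmul hs ht hst)
      (div_nonneg (hone t ht).le (hone' t ht).le) (div_nonneg (hl s hs) (hone s hs).le)
  · exact div_nonneg (hl t ht) (hone' t ht).le
  · refine mul_nonneg (hone' t ht).le (kernelGap_nonneg_of_le hc (mul_pos hr0 ht.1).le ?_)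
    nlinarith [ht.1]
  · have hneg : kernelGap c (r * s) < 0 := by
      by_contra! hn
      exact absurd (mul_nonneg (hone' s hs).le hn) (not_le.mpr h)
    refine mul_nonpos_of_nonneg_of_nonpos (hone' t ht).le
      (kernelGap_nonpos_of_neg hc (mul_pos hr0 hs.1).le ?_ ?_ hneg)
    · nlinarith
    · nlinarith [ht.1, ht.2]
  · have := intervalIntegral.integral_comp_mul_left (a := 0) (b := 1)
      (fun v => (1 - v ^ 2) * kernelGap c v) hr0.ne'
    simp only [mul_zero, mul_one, smul_eq_mul] at this
    rw [this]
    exact mul_nonneg (inv_nonneg.mpr hr) (integral_kernelGap_nonneg hc hr hr1)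
  · refine (hi.mul_continuousOn hcont).congr_uIoo ?_
    rw [uIoo_of_le zero_le_one]
    exact hEφ

/-! ### Averages over dilations -/

lemma rpow_mem_Icc {p σ : ℝ} (hp : 0 ≤ p) (hσ : σ ∈ Icc (0 : ℝ) 1) : σ ^ p ∈ Icc (0 : ℝ) 1 :=
  ⟨Real.rpow_nonneg hσ.1 p, Real.rpow_le_one hσ.1 hσ.2 hp⟩

lemma mul_rpow_mem_Icc {p t σ : ℝ} (hp : 0 ≤ p) (ht : t ∈ Icc (0 : ℝ) 1)
    (hσ : σ ∈ Icc (0 : ℝ) 1) : t * σ ^ p ∈ Icc (0 : ℝ) 1 :=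
  ⟨mul_nonneg ht.1 (rpow_mem_Icc hp hσ).1,
    mul_le_one₀ ht.2 (rpow_mem_Icc hp hσ).1 (rpow_mem_Icc hp hσ).2⟩

/-- Precomposition with the clamp onto `[0, 1]` gives global continuity and a bound, as needed for
parametric integrals and Fubini. -/
lemma exists_continuous_eqOn {E : Type*} [NormedAddCommGroup E] {g : ℝ → E} (hg : ContinuousOn g (Icc 0 1)) :
    ∃ G : ℝ → E, Continuous G ∧ EqOn G g (Icc 0 1) ∧ ∃ C, ∀ t, ‖G t‖ ≤ C := by
  have hmem : ∀ t : ℝ, max 0 (min 1 t) ∈ Icc (0 : ℝ) 1 := fun t =>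
    ⟨le_max_left _ _, max_le zero_le_one (min_le_left _ _)⟩
  obtain ⟨C, hC⟩ := isCompact_Icc.exists_bound_of_continuousOn hg
  refine ⟨fun t => g (max 0 (min 1 t)), hg.comp_continuous (by fun_prop) hmem,
    fun t ht => ?_, C, fun t => hC _ (hmem t)⟩
  simp [ht.1, ht.2]

lemma continuousOn_comp_mul_rpow {p : ℝ} (hp : 0 ≤ p) {E : Type*} [NormedAddCommGroup E] {g : ℝ → E} (hg : ContinuousOn g (Icc 0 1))
    {t : ℝ} (ht : t ∈ Icc (0 : ℝ) 1) : ContinuousOn (fun σ => g (t * σ ^ p)) (Icc 0 1) := by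
  have := Real.continuous_rpow_const hp
  exact hg.comp (by fun_prop) fun σ hσ => mul_rpow_mem_Icc hp ht hσ

lemma intervalIntegrable_comp_mul_rpow {p : ℝ} (hp : 0 ≤ p) {E : Type*} [NormedAddCommGroup E] {g : ℝ → E}
    (hg : ContinuousOn g (Icc 0 1)) {t : ℝ} (ht : t ∈ Icc (0 : ℝ) 1) :
    IntervalIntegrable (fun σ => g (t * σ ^ p)) volume 0 1 := by
  refine ContinuousOn.intervalIntegrable ?_
  rw [uIcc_of_le zero_le_one]
  exact continuousOn_comp_mul_rpow hp hg ht

section PowerAvg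

variable {E : Type*} [NormedAddCommGroup E] [NormedSpace ℝ E]

/-- The average of `g` over the dilations `t ↦ t σ ^ p`, `0 < σ < 1`. -/
noncomputable def powerAvg (p : ℝ) (g : ℝ → E) (t : ℝ) : E := ∫ σ in (0 : ℝ)..1, g (t * σ ^ p)

lemma continuous_powerAvg {p : ℝ} (hp : 0 ≤ p) {g : ℝ → E} (hg : Continuous g) :
    Continuous (powerAvg p g) := by
  refine intervalIntegral.continuous_parametric_intervalIntegral_of_continuous' ?_ 0 1
  have := Real.continuous_rpow_const hp
  change Continuous fun x : ℝ × ℝ => g (x.1 * x.2 ^ p)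
  fun_prop

lemma powerAvg_congr {p : ℝ} (hp : 0 ≤ p) {g G : ℝ → E} (h : EqOn G g (Icc 0 1)) :
    EqOn (powerAvg p G) (powerAvg p g) (Icc 0 1) := fun t ht => by
  refine intervalIntegral.integral_congr fun σ hσ => h (mul_rpow_mem_Icc hp ht ?_)
  rwa [uIcc_of_le zero_le_one] at hσ

lemma continuousOn_powerAvg {p : ℝ} (hp : 0 ≤ p) {g : ℝ → E} (hg : ContinuousOn g (Icc 0 1)) :
    ContinuousOn (powerAvg p g) (Icc 0 1) := by
  obtain ⟨G, hG, hGg, -⟩ := exists_continuous_eqOn hg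
  exact (continuous_powerAvg hp hG).continuousOn.congr (powerAvg_congr hp hGg).symm

lemma powerAvg_mono {p : ℝ} (hp : 0 ≤ p) {f g : ℝ → ℝ} (hf : ContinuousOn f (Icc 0 1))
    (hg : ContinuousOn g (Icc 0 1)) (h : ∀ t ∈ Icc (0 : ℝ) 1, f t ≤ g t) {t : ℝ}
    (ht : t ∈ Icc (0 : ℝ) 1) : powerAvg p f t ≤ powerAvg p g t :=
  intervalIntegral.integral_mono_on zero_le_one (intervalIntegrable_comp_mul_rpow hp hf ht)
    (intervalIntegrable_comp_mul_rpow hp hg ht) fun _ hσ => h _ (mul_rpow_mem_Icc hp ht hσ)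

lemma integral_mul_powerAvg {lam : ℝ → ℝ} (hi : IntervalIntegrable lam volume 0 1) {p : ℝ}
    (hp : 0 ≤ p) {g : ℝ → ℝ} (hg : ContinuousOn g (Icc 0 1)) :
    ∫ t in (0 : ℝ)..1, lam t * powerAvg p g t
      = ∫ τ in (0 : ℝ)..1, ∫ t in (0 : ℝ)..1, lam t * g (t * τ ^ p) := by
  obtain ⟨G, hG, hGg, C, hC⟩ := exists_continuous_eqOn hg
  have e1 : ∫ t in (0 : ℝ)..1, lam t * powerAvg p g t
      = ∫ t in (0 : ℝ)..1, ∫ τ in (0 : ℝ)..1, lam t * G (t * τ ^ p) := by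
    refine intervalIntegral.integral_congr fun t ht => ?_
    rw [uIcc_of_le zero_le_one] at ht
    simp only [intervalIntegral.integral_const_mul]
    rw [← powerAvg_congr hp hGg ht]
    rfl
  have e2 : ∫ τ in (0 : ℝ)..1, ∫ t in (0 : ℝ)..1, lam t * g (t * τ ^ p)
      = ∫ τ in (0 : ℝ)..1, ∫ t in (0 : ℝ)..1, lam t * G (t * τ ^ p) := by
    refine intervalIntegral.integral_congr fun τ hτ => intervalIntegral.integral_congr fun t ht => ?_
    rw [uIcc_of_le zero_le_one] at hτ ht
    simp only [hGg (mul_rpow_mem_Icc hp ht hτ)]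
  rw [e1, e2]
  simp only [intervalIntegral.integral_of_le (zero_le_one' ℝ)]
  refine integral_integral_swap ?_
  have hcont : Continuous fun x : ℝ × ℝ => G (x.1 * x.2 ^ p) := by
    have := Real.continuous_rpow_const hp
    fun_prop
  have hl : Integrable (fun x : ℝ × ℝ => lam x.1)
      ((volume.restrict (Ioc (0 : ℝ) 1)).prod (volume.restrict (Ioc (0 : ℝ) 1))) :=
    ((intervalIntegrable_iff_integrableOn_Ioc_of_le zero_le_one).mp hi).comp_fst _
  refine (hl.bdd_mul (c := C) hcont.aestronglyMeasurable
    (Filter.Eventually.of_forall fun x => hC _)).congr (Filter.Eventually.of_forall fun x => ?_)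
  simp [Function.uncurry, mul_comm]

/-- Termwise integration, with `∫ σ^(p n) = 1 / (1 + p n)` over `[0, 1]`. -/
lemma hasSum_powerAvg {p : ℝ} (hp : 0 ≤ p) {g : ℝ → ℂ} {a : ℕ → ℂ}
    (h : ∀ t ∈ Ico (0 : ℝ) 1, HasSum (fun n => a n * (t : ℂ) ^ n) (g t)) {t : ℝ}
    (ht : t ∈ Ico (0 : ℝ) 1) :
    HasSum (fun n : ℕ => a n / (1 + p * n) * (t : ℂ) ^ n) (powerAvg p g t) := by
  have hs : Summable fun n => ‖a n * (t : ℂ) ^ n‖ := (h t ht).summable.norm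
  have hmem : ∀ σ ∈ uIoc (0 : ℝ) 1, σ ∈ Icc (0 : ℝ) 1 := fun σ hσ => by
    rw [uIoc_of_le zero_le_one] at hσ
    exact ⟨hσ.1.le, hσ.2⟩
  have hrp : Continuous fun σ : ℝ => σ ^ p := Real.continuous_rpow_const hp
  have key := intervalIntegral.hasSum_integral_of_dominated_convergence (μ := volume)
    (a := (0 : ℝ)) (b := 1)
    (F := fun n σ => a n * ((t * σ ^ p : ℝ) : ℂ) ^ n) (f := fun σ => g (t * σ ^ p))
    (fun n _ => ‖a n * (t : ℂ) ^ n‖) (fun n => ?_) (fun n => ?_) ?_ ?_ ?_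
  · refine key.congr_fun fun n => ?_
    have e : ∀ σ ∈ uIcc (0 : ℝ) 1, a n * ((t * σ ^ p : ℝ) : ℂ) ^ n
        = a n * (t : ℂ) ^ n * ((σ ^ (p * n) : ℝ) : ℂ) := fun σ hσ => by
      rw [uIcc_of_le zero_le_one] at hσ
      rw [Real.rpow_mul hσ.1, Real.rpow_natCast]
      push_cast
      ring
    have hpn : 0 ≤ p * n := by positivity
    rw [intervalIntegral.integral_congr e, intervalIntegral.integral_const_mul,
      intervalIntegral.integral_ofReal, integral_rpow (Or.inl (by linarith)), Real.one_rpow,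
      Real.zero_rpow (by linarith)]
    push_cast
    ring
  · exact Continuous.aestronglyMeasurable (by fun_prop)
  · refine Filter.Eventually.of_forall fun σ hσ => ?_
    have := rpow_mem_Icc hp (hmem σ hσ)
    simp only [norm_mul, norm_pow, Complex.norm_real, Real.norm_of_nonneg this.1,
      Real.norm_of_nonneg ht.1]
    have : (t * σ ^ p) ^ n ≤ t ^ n :=
      pow_le_pow_left₀ (mul_nonneg ht.1 this.1) (mul_le_of_le_one_right ht.1 this.2) n
    simpa [abs_of_nonneg ht.1, abs_of_nonneg (rpow_mem_Icc hp (hmem σ hσ)).1] using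
      mul_le_mul_of_nonneg_left this (norm_nonneg (a n))
  · exact Filter.Eventually.of_forall fun σ _ => hs
  · exact intervalIntegrable_const
  · refine Filter.Eventually.of_forall fun σ hσ => ?_
    have := rpow_mem_Icc hp (hmem σ hσ)
    exact h _ ⟨mul_nonneg ht.1 this.1, (mul_le_of_le_one_right ht.1 this.2).trans_lt ht.2⟩

end PowerAvg

/-! ### The gap inequality for averaged kernels -/

/-- The extremal inequality after averaging, for weights with `lam t / (1 - t²)` decreasing. -/
lemma integral_weight_mul_powerAvg_nonneg {lam : ℝ → ℝ} (hl : ∀ t ∈ Ioo (0 : ℝ) 1, 0 ≤ lam t)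
    (hi : IntervalIntegrable lam volume 0 1)
    (ha : AntitoneOn (fun t => lam t / (1 - t ^ 2)) (Ioo 0 1)) {p : ℝ} (hp : 0 ≤ p)
    {c r : ℝ} (hc : |c| ≤ 1) (hr : 0 ≤ r) (hr1 : r < 1) :
    0 ≤ ∫ t in (0 : ℝ)..1, lam t * powerAvg p (fun u => kernelGap c (r * u)) t := by
  -- After Fubini each slice is the unaveraged inequality with radius `r τ^p < 1`.
  rw [integral_mul_powerAvg hi hp (continuousOn_kernelGap_mul hc hr hr1)]
  refine intervalIntegral.integral_nonneg zero_le_one fun τ hτ => ?_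
  have hτ' := rpow_mem_Icc hp hτ
  convert integral_weight_mul_kernelGap_nonneg hl hi ha hc (mul_nonneg hr hτ'.1)
    ((mul_le_of_le_one_right hr hτ'.2).trans_lt hr1) using 5
  ring

/-- The extremal inequality after averaging, for weights with `lam t * t ^ (-1 - 1 / p)`
decreasing. -/
lemma integral_weight_mul_powerAvg_nonneg' {lam : ℝ → ℝ} (hl : ∀ t ∈ Ioo (0 : ℝ) 1, 0 ≤ lam t)
    (hi : IntervalIntegrable lam volume 0 1) {p : ℝ} (hp : 1 ≤ p)
    (ha : AntitoneOn (fun t => lam t * t ^ (-1 - 1 / p)) (Ioo 0 1))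
    {c r : ℝ} (hc : |c| ≤ 1) (hr : 0 ≤ r) (hr1 : r < 1) :
    0 ≤ ∫ t in (0 : ℝ)..1, lam t * powerAvg p (fun u => kernelGap c (r * u)) t := by
  have hp0 : 0 < p := by linarith
  have hpi : 0 < 1 / p := by positivity
  have hgap := continuousOn_kernelGap_mul hc hr hr1
  have hFc := continuousOn_comp_mul_rpow hp0.le hgap (t := 1) (by simp)
  obtain ⟨F, hF, hFeq, -⟩ := exists_continuous_eqOn hFc
  simp only [one_mul] at hFeq
  set N : ℝ → ℝ := fun T => ∫ y in (0 : ℝ)..T, F y with hN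
  have hNd : ∀ T, HasDerivAt N (F T) T := fun T => (hF.integral_hasStrictDerivAt 0 T).hasDerivAt
  have hNc : Continuous N := continuous_iff_continuousAt.mpr fun T => (hNd T).continuousAt
  have hroot : ∀ t ∈ Icc (0 : ℝ) 1, (t ^ (1 / p)) ^ p = t := fun t ht => by
    rw [← Real.rpow_mul ht.1, one_div_mul_cancel hp0.ne', Real.rpow_one]
  -- The substitution `y = t^(1/p) σ` turns the average into `t^(-1/p) N(t^(1/p))`; a further factor
  -- `t` is split off so that the decreasing weight appears.
  have hA : ∀ t ∈ Ioo (0 : ℝ) 1, lam t * powerAvg p (fun u => kernelGap c (r * u)) t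
      = lam t * t ^ (-1 - 1 / p) * (t * N (t ^ (1 / p))) := by
    intro t ht
    have ht' : t ∈ Icc (0 : ℝ) 1 := ⟨ht.1.le, ht.2.le⟩
    have hT := rpow_mem_Icc hpi.le ht'
    have h1 : t ^ (1 / p) * powerAvg p (fun u => kernelGap c (r * u)) t = N (t ^ (1 / p)) := by
      have := intervalIntegral.mul_integral_comp_mul_left (a := 0) (b := 1) (f := F)
        (t ^ (1 / p))
      rw [mul_zero, mul_one] at this
      change _ = ∫ y in (0 : ℝ)..(t ^ (1 / p)), F y
      rw [← this, powerAvg]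
      congr 1
      refine intervalIntegral.integral_congr fun σ hσ => ?_
      rw [uIcc_of_le zero_le_one] at hσ
      rw [hFeq ⟨mul_nonneg hT.1 hσ.1, mul_le_one₀ hT.2 hσ.1 hσ.2⟩]
      simp only
      rw [Real.mul_rpow hT.1 hσ.1, hroot t ht']
    rw [← h1, Real.rpow_sub ht.1, Real.rpow_neg_one]
    have := (Real.rpow_pos_of_pos ht.1 (1 / p)).ne'
    have := ht.1.ne'
    field_simp
  rw [intervalIntegral.integral_congr_Ioo_of_le zero_le_one hA]
  have hFnn : ∀ y ∈ Icc (0 : ℝ) 1, y ^ p ≤ 1 / 4 → 0 ≤ F y := fun y hy h => by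
    rw [hFeq hy]
    have := (rpow_mem_Icc hp0.le hy).1
    exact kernelGap_nonneg_of_le hc (mul_nonneg hr this) (by nlinarith)
  have hφc : Continuous fun t : ℝ => t * N (t ^ (1 / p)) := by
    have := Real.continuous_rpow_const hpi.le
    fun_prop
  refine integral_antitone_mul_nonneg (δ := 1 / 4) ha
    (fun t ht => mul_nonneg (hl t ht) (Real.rpow_nonneg ht.1.le _)) (by norm_num)
    (fun t ht h => ?_) (fun s hs t ht hst h => ?_) (hφc.intervalIntegrable 0 1) ?_ ?_
  · have ht' : t ∈ Icc (0 : ℝ) 1 := ⟨ht.1.le, ht.2.le⟩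
    have hT := rpow_mem_Icc hpi.le ht'
    refine mul_nonneg ht.1.le (intervalIntegral.integral_nonneg hT.1 fun y hy => ?_)
    refine hFnn y ⟨hy.1, hy.2.trans hT.2⟩ (le_trans ?_ h)
    exact (Real.rpow_le_rpow hy.1 hy.2 hp0.le).trans_eq (hroot t ht')
  -- If `N` is negative at `s^(1/p)`, its integrand `F` was negative somewhere before, hence is
  -- non-positive from there on, and `N` stays negative.
  · have hS := rpow_mem_Icc hpi.le (⟨hs.1.le, hs.2.le⟩ : s ∈ Icc (0 : ℝ) 1)
    have hT := rpow_mem_Icc hpi.le (⟨ht.1.le, ht.2.le⟩ : t ∈ Icc (0 : ℝ) 1)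
    have hST : s ^ (1 / p) ≤ t ^ (1 / p) := Real.rpow_le_rpow hs.1.le hst.le hpi.le
    have hNS : N (s ^ (1 / p)) < 0 := by
      by_contra! hn
      exact absurd (mul_nonneg hs.1.le hn) (not_le.mpr h)
    obtain ⟨y, hy, hFy⟩ : ∃ y ∈ Icc 0 (s ^ (1 / p)), F y < 0 := by
      by_contra! hn
      exact absurd (intervalIntegral.integral_nonneg hS.1 hn) (not_le.mpr hNS)
    have htail : ∫ y in (s ^ (1 / p))..(t ^ (1 / p)), F y ≤ 0 := by
      rw [← neg_nonneg, ← intervalIntegral.integral_neg]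
      refine intervalIntegral.integral_nonneg hST fun x hx => neg_nonneg.mpr ?_
      have hy' : y ∈ Icc (0 : ℝ) 1 := ⟨hy.1, hy.2.trans hS.2⟩
      have hx' : x ∈ Icc (0 : ℝ) 1 := ⟨hS.1.trans hx.1, hx.2.trans hT.2⟩
      rw [hFeq hx']
      rw [hFeq hy'] at hFy
      have hyx : y ^ p ≤ x ^ p := Real.rpow_le_rpow hy.1 (hy.2.trans hx.1) hp0.le
      have := rpow_mem_Icc hp0.le hx'
      exact kernelGap_nonpos_of_neg hc (mul_nonneg hr (rpow_mem_Icc hp0.le hy').1)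
        (mul_le_mul_of_nonneg_left hyx hr) (mul_le_one₀ hr1.le this.1 this.2) hFy
    have hadd := intervalIntegral.integral_add_adjacent_intervals
      (hF.intervalIntegrable 0 (s ^ (1 / p)) (μ := volume))
      (hF.intervalIntegrable (s ^ (1 / p)) (t ^ (1 / p)))
    refine mul_nonpos_of_nonneg_of_nonpos ht.1.le ?_
    change ∫ y in (0 : ℝ)..(t ^ (1 / p)), F y ≤ 0
    rw [← hadd]
    change N (s ^ (1 / p)) + _ ≤ 0
    linarith
  -- Integrating `t N(t^(1/p))` by parts with the primitive `(t² - 1)/2`, whose product with `N`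
  -- vanishes at both ends, gives the gap integral with weight `w`. Here `w/(1 - t²)` decreases
  -- because `p ≥ 1`.
  · set w : ℝ → ℝ := fun t => (1 - t ^ 2) / 2 * (1 / p * t ^ (1 / p - 1)) with hw
    have hwi : IntervalIntegrable w volume 0 1 :=
      ((intervalIntegral.intervalIntegrable_rpow' (by linarith)).const_mul (1 / p)).continuousOn_mul
        (by fun_prop)
    have hgap' := hgap
    rw [← uIcc_of_le (zero_le_one' ℝ)] at hgap'
    have hparts : ∫ t in (0 : ℝ)..1, (t * N (t ^ (1 / p)) - w t * kernelGap c (r * t)) = 0 := by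
      rw [intervalIntegral.integral_eq_sub_of_hasDerivAt_of_le
        (f := fun t => (t ^ 2 - 1) / 2 * N (t ^ (1 / p))) zero_le_one ?_ (fun t ht => ?_)
        ((hφc.intervalIntegrable 0 1).sub (hwi.mul_continuousOn hgap'))]
      · simp [hN, Real.zero_rpow (inv_pos.mpr hp0).ne']
      · have := Real.continuous_rpow_const hpi.le
        exact Continuous.continuousOn (by fun_prop)
      · have ht' : t ∈ Icc (0 : ℝ) 1 := ⟨ht.1.le, ht.2.le⟩
        have h1 := ((hasDerivAt_pow 2 t).sub_const 1).div_const 2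
        have h2 := (hNd (t ^ (1 / p))).comp t (Real.hasDerivAt_rpow_const (Or.inl ht.1.ne'))
        refine (h1.mul h2).congr_deriv ?_
        rw [hFeq (rpow_mem_Icc hpi.le ht')]
        simp only [hroot t ht', hw, Function.comp]
        norm_num
        ring
    rw [intervalIntegral.integral_sub (hφc.intervalIntegrable 0 1)
      (hwi.mul_continuousOn hgap'), sub_eq_zero] at hparts
    rw [hparts]
    refine integral_weight_mul_kernelGap_nonneg (fun t ht => ?_) hwi ?_ hc hr hr1
    · have : 0 ≤ 1 - t ^ 2 := by nlinarith [ht.1, ht.2]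
      have := Real.rpow_nonneg ht.1.le (1 / p - 1)
      positivity
    · have e : ∀ t ∈ Ioo (0 : ℝ) 1, w t / (1 - t ^ 2) = 1 / 2 * (1 / p * t ^ (1 / p - 1)) := by
        intro t ht
        have : (1 : ℝ) - t ^ 2 ≠ 0 := by nlinarith [ht.1, ht.2]
        simp only [hw]
        field_simp
      intro s hs t ht hst
      simp only
      rw [e s hs, e t ht]
      have : t ^ (1 / p - 1) ≤ s ^ (1 / p - 1) :=
        Real.rpow_le_rpow_of_nonpos hs.1 hst (by
          rw [sub_nonpos, div_le_one hp0]; exact hp)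
      gcongr
  · refine (hi.mul_continuousOn ((continuousOn_powerAvg hp0.le hgap).mono
      (uIcc_of_le (zero_le_one' ℝ)).subset)).congr_uIoo ?_
    rw [uIoo_of_le zero_le_one]
    exact hA

/-! ### The multiplier as a combination of averages -/

section Averages

variable {E F : Type*} [NormedAddCommGroup E] [NormedSpace ℝ E] [NormedAddCommGroup F]
  [NormedSpace ℝ F]

/-- The averaging operator that multiplies the `n`-th Taylor coefficient by
`(1 + ξ n) / ((1 + p n) (1 + q n))`. -/
noncomputable def pascuAvg (ξ p q : ℝ) (g : ℝ → E) (t : ℝ) : E :=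
  (ξ / q) • powerAvg p g t + (1 - ξ / q) • powerAvg q (powerAvg p g) t

lemma continuousOn_pascuAvg {ξ p q : ℝ} (hp : 0 ≤ p) (hq : 0 ≤ q) {g : ℝ → E}
    (hg : ContinuousOn g (Icc 0 1)) : ContinuousOn (pascuAvg ξ p q g) (Icc 0 1) :=
  ((continuousOn_powerAvg hp hg).const_smul _).add
    ((continuousOn_powerAvg hq (continuousOn_powerAvg hp hg)).const_smul _)

lemma powerAvg_clm [CompleteSpace E] [CompleteSpace F] (L : E →L[ℝ] F) {p : ℝ} (hp : 0 ≤ p)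
    {g : ℝ → E} (hg : ContinuousOn g (Icc 0 1)) :
    EqOn (powerAvg p fun t => L (g t)) (fun t => L (powerAvg p g t)) (Icc 0 1) := fun _ ht =>
  L.intervalIntegral_comp_comm (intervalIntegrable_comp_mul_rpow hp hg ht)

lemma pascuAvg_clm [CompleteSpace E] [CompleteSpace F] (L : E →L[ℝ] F) {ξ p q : ℝ} (hp : 0 ≤ p)
    (hq : 0 ≤ q) {g : ℝ → E} (hg : ContinuousOn g (Icc 0 1)) {t : ℝ} (ht : t ∈ Icc (0 : ℝ) 1) :
    pascuAvg ξ p q (fun t => L (g t)) t = L (pascuAvg ξ p q g t) := by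
  unfold pascuAvg
  rw [powerAvg_clm L hp hg ht, powerAvg_congr hq (powerAvg_clm L hp hg) ht,
    powerAvg_clm L hq (continuousOn_powerAvg hp hg) ht, map_add, map_smul, map_smul]

lemma powerAvg_add {p : ℝ} (hp : 0 ≤ p) {f g : ℝ → E} (hf : ContinuousOn f (Icc 0 1))
    (hg : ContinuousOn g (Icc 0 1)) :
    EqOn (powerAvg p fun t => f t + g t) (fun t => powerAvg p f t + powerAvg p g t) (Icc 0 1) :=
  fun _ ht => intervalIntegral.integral_add (intervalIntegrable_comp_mul_rpow hp hf ht)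
    (intervalIntegrable_comp_mul_rpow hp hg ht)

lemma pascuAvg_add {ξ p q : ℝ} (hp : 0 ≤ p) (hq : 0 ≤ q) {f g : ℝ → E}
    (hf : ContinuousOn f (Icc 0 1)) (hg : ContinuousOn g (Icc 0 1)) {t : ℝ}
    (ht : t ∈ Icc (0 : ℝ) 1) :
    pascuAvg ξ p q (fun t => f t + g t) t = pascuAvg ξ p q f t + pascuAvg ξ p q g t := by
  unfold pascuAvg
  rw [powerAvg_add hp hf hg ht, powerAvg_congr hq (powerAvg_add hp hf hg) ht,
    powerAvg_add hq (continuousOn_powerAvg hp hf) (continuousOn_powerAvg hp hg) ht, smul_add,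
    smul_add]
  abel

end Averages

/-- The condition `ξ ≤ q` makes both coefficients `ξ/q` and `1 - ξ/q` non-negative. -/
lemma pascuAvg_mono {ξ p q : ℝ} (hp : 0 ≤ p) (hξ : 0 ≤ ξ) (hq : 0 < q) (hξq : ξ ≤ q) {f g : ℝ → ℝ}
    (hf : ContinuousOn f (Icc 0 1)) (hg : ContinuousOn g (Icc 0 1))
    (h : ∀ t ∈ Icc (0 : ℝ) 1, f t ≤ g t) {t : ℝ} (ht : t ∈ Icc (0 : ℝ) 1) :
    pascuAvg ξ p q f t ≤ pascuAvg ξ p q g t := by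
  have h1 : ∀ t ∈ Icc (0 : ℝ) 1, powerAvg p f t ≤ powerAvg p g t :=
    fun t ht => powerAvg_mono hp hf hg h ht
  have h2 := powerAvg_mono hq.le (continuousOn_powerAvg hp hf) (continuousOn_powerAvg hp hg) h1 ht
  have h3 : ξ / q ≤ 1 := (div_le_one hq).mpr hξq
  exact add_le_add (mul_le_mul_of_nonneg_left (h1 t ht) (by positivity))
    (mul_le_mul_of_nonneg_left h2 (by linarith))

/-- Partial fractions: `(1 + ξ n)/(1 + q n) = ξ/q + (1 - ξ/q)/(1 + q n)`. -/
lemma hasSum_pascuAvg {ξ p q : ℝ} (hp : 0 ≤ p) (hq : 0 < q) {g : ℝ → ℂ} {a : ℕ → ℂ}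
    (h : ∀ t ∈ Ico (0 : ℝ) 1, HasSum (fun n => a n * (t : ℂ) ^ n) (g t)) {t : ℝ}
    (ht : t ∈ Ico (0 : ℝ) 1) :
    HasSum (fun n : ℕ => a n * ((1 + ξ * n) / ((1 + p * n) * (1 + q * n))) * (t : ℂ) ^ n)
      (pascuAvg ξ p q g t) := by
  have h1 : ∀ t ∈ Ico (0 : ℝ) 1, HasSum _ (powerAvg p g t) := fun t ht => hasSum_powerAvg hp h ht
  have h2 := ((h1 t ht).const_smul (ξ / q)).add
    ((hasSum_powerAvg hq.le h1 ht).const_smul (1 - ξ / q))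
  refine h2.congr_fun fun n => ?_
  have e1 : (1 + p * n : ℂ) ≠ 0 := by
    exact_mod_cast (by positivity : (1 + p * n : ℝ) ≠ 0)
  have e2 : (1 + q * n : ℂ) ≠ 0 := by
    exact_mod_cast (by positivity : (1 + q * n : ℝ) ≠ 0)
  have e3 : (q : ℂ) ≠ 0 := by exact_mod_cast hq.ne'
  simp only [Complex.real_smul]
  push_cast
  generalize (1 + p * n : ℂ) = P at e1 ⊢
  obtain ⟨Q, hQ⟩ : ∃ Q : ℂ, Q = 1 + q * n := ⟨_, rfl⟩
  have hn : (n : ℂ) = (Q - 1) / q := by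
    rw [hQ]
    field_simp
    ring
  rw [← hQ] at e2 ⊢
  rw [hn]
  field_simp
  ring

/-! ### Extremal starlike kernels and the condition on `β` -/

/-- The extremal starlike functions `h`, as `u ↦ h (u z) / (u z)`. -/
noncomputable def starKernel (x z : ℂ) (u : ℝ) : ℂ :=
  (1 + (x - 1) / 2 * (u * z)) / (1 - u * z) ^ 2

lemma one_sub_ne_zero_of_norm_lt {w : ℂ} (hw : ‖w‖ < 1) : 1 - w ≠ 0 := by
  intro h
  rw [← sub_eq_zero.mp h] at hw
  simp at hw

lemma hasSum_starKernel (x : ℂ) {w : ℂ} (hw : ‖w‖ < 1) :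
    HasSum (fun n : ℕ => (1 + n * ((1 + x) / 2)) * w ^ n)
      ((1 + (x - 1) / 2 * w) / (1 - w) ^ 2) := by
  have h1 := hasSum_geometric_of_norm_lt_one hw
  have h2 := (hasSum_coe_mul_geometric_of_norm_lt_one hw).mul_left ((1 + x) / 2)
  have hne := one_sub_ne_zero_of_norm_lt hw
  have e : (1 + (x - 1) / 2 * w) / (1 - w) ^ 2
      = (1 - w)⁻¹ + (1 + x) / 2 * (w / (1 - w) ^ 2) := by
    field_simp
    ring
  rw [e]
  exact (h1.add h2).congr_fun fun n => by ring

lemma norm_ofReal_mul_lt {z : ℂ} (hz : ‖z‖ < 1) {t : ℝ} (ht : t ∈ Icc (0 : ℝ) 1) :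
    ‖(t : ℂ) * z‖ < 1 := by
  rw [norm_mul, Complex.norm_real, Real.norm_of_nonneg ht.1]
  exact (mul_le_of_le_one_left (norm_nonneg z) ht.2).trans_lt hz

lemma continuousOn_starKernel (x : ℂ) {z : ℂ} (hz : ‖z‖ < 1) :
    ContinuousOn (starKernel x z) (Icc 0 1) := by
  unfold starKernel
  refine ContinuousOn.div (by fun_prop) (by fun_prop) fun t ht => pow_ne_zero _ ?_
  exact one_sub_ne_zero_of_norm_lt (norm_ofReal_mul_lt hz ht)

lemma continuousOn_one_div_one_add_sq :
    ContinuousOn (fun u : ℝ => 1 / (1 + u) ^ 2) (Icc 0 1) := by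
  refine ContinuousOn.div (by fun_prop) (by fun_prop) fun t ht => ?_
  have := ht.1
  positivity

/-- Write `z = ‖z‖ ζ` and apply `kernelGap_le_re` at `v = ‖z‖ u`. Lowering `1/(1 + ‖z‖ u)²` to `1/(1
+ u)²` makes the comparison term independent of `z`. -/
lemma kernelGap_add_le_re_starKernel {x z : ℂ} (hx : ‖x‖ ≤ 1) (hz : ‖z‖ < 1) :
    ∃ c : ℝ, |c| ≤ 1 ∧ ∀ u ∈ Icc (0 : ℝ) 1,
      kernelGap c (‖z‖ * u) + 1 / (1 + u) ^ 2 ≤ (starKernel x z u).re := by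
  obtain ⟨ζ, hζ, hzζ⟩ : ∃ ζ : ℂ, ‖ζ‖ = 1 ∧ z = ‖z‖ * ζ := by
    rcases eq_or_ne z 0 with rfl | h
    · exact ⟨1, by simp, by simp⟩
    · have : (‖z‖ : ℂ) ≠ 0 := by exact_mod_cast (norm_pos_iff.mpr h).ne'
      refine ⟨z / ‖z‖, ?_, by field_simp⟩
      rw [norm_div, Complex.norm_real, norm_norm, div_self (norm_pos_iff.mpr h).ne']
  refine ⟨ζ.re, (Complex.abs_re_le_norm ζ).trans hζ.le, fun u hu => ?_⟩
  have hv : 0 ≤ ‖z‖ * u := mul_nonneg (norm_nonneg z) hu.1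
  have hv1 : ‖z‖ * u ≤ u := mul_le_of_le_one_left hu.1 hz.le
  have hlt : ‖z‖ * u < 1 := by nlinarith [hu.1, hu.2, norm_nonneg z]
  have h := kernelGap_le_re hx hζ hv hlt
  have h2 : 1 / (1 + u) ^ 2 ≤ 1 / (1 + ‖z‖ * u) ^ 2 := by gcongr
  have e : ((‖z‖ * u : ℝ) : ℂ) * ζ = u * z := by
    conv_rhs => rw [hzζ]
    push_cast
    ring
  rw [e] at h
  change _ ≤ ((1 + (x - 1) / 2 * (u * z)) / (1 - u * z) ^ 2).re
  linarith

/-- The extremal property that a weight has to have for the averaged gap. -/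
def HasGapProperty (lam : ℝ → ℝ) (p : ℝ) : Prop :=
  ∀ c r : ℝ, |c| ≤ 1 → 0 ≤ r → r < 1 →
    0 ≤ ∫ t in (0 : ℝ)..1, lam t * powerAvg p (fun u => kernelGap c (r * u)) t

lemma intervalIntegrable_mul_of_continuousOn {lam : ℝ → ℝ} (hi : IntervalIntegrable lam volume 0 1)
    {g : ℝ → ℝ} (hg : ContinuousOn g (Icc 0 1)) :
    IntervalIntegrable (fun t => lam t * g t) volume 0 1 :=
  hi.mul_continuousOn (by rwa [uIcc_of_le zero_le_one])

/-- The gap property is asked for all radii below 1, so it survives the outer average over `τ^q`,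
which only shrinks the radius. -/
lemma integral_mul_pascuAvg_kernelGap_nonneg {lam : ℝ → ℝ} (hi : IntervalIntegrable lam volume 0 1)
    {ξ p q : ℝ} (hp : 0 ≤ p) (hξ : 0 ≤ ξ) (hq : 0 < q) (hξq : ξ ≤ q) (H : HasGapProperty lam p)
    {c r : ℝ} (hc : |c| ≤ 1) (hr : 0 ≤ r) (hr1 : r < 1) :
    0 ≤ ∫ t in (0 : ℝ)..1, lam t * pascuAvg ξ p q (fun u => kernelGap c (r * u)) t := by
  have hg := continuousOn_kernelGap_mul hc hr hr1
  have h1 := continuousOn_powerAvg hp hg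
  have h2 := continuousOn_powerAvg hq.le h1
  have e : ∀ t, lam t * pascuAvg ξ p q (fun u => kernelGap c (r * u)) t
      = ξ / q * (lam t * powerAvg p (fun u => kernelGap c (r * u)) t)
        + (1 - ξ / q) * (lam t * powerAvg q (powerAvg p fun u => kernelGap c (r * u)) t) := by
    intro t
    simp only [pascuAvg, smul_eq_mul]
    ring
  simp only [e]
  rw [intervalIntegral.integral_add
    ((intervalIntegrable_mul_of_continuousOn hi h1).const_mul _)
    ((intervalIntegrable_mul_of_continuousOn hi h2).const_mul _),
    intervalIntegral.integral_const_mul, intervalIntegral.integral_const_mul]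
  have h3 : ξ / q ≤ 1 := (div_le_one hq).mpr hξq
  refine add_nonneg (mul_nonneg (by positivity) (H c r hc hr hr1))
    (mul_nonneg (by linarith) ?_)
  rw [integral_mul_powerAvg hi hq.le h1]
  refine intervalIntegral.integral_nonneg zero_le_one fun τ hτ => ?_
  have hτ' := rpow_mem_Icc hq.le hτ
  refine (H c (r * τ ^ q) hc (mul_nonneg hr hτ'.1)
    ((mul_le_of_le_one_right hr hτ'.2).trans_lt hr1)).trans_eq
    (intervalIntegral.integral_congr fun t _ => congrArg (lam t * ·)
      (intervalIntegral.integral_congr fun σ _ => congrArg (kernelGap c) ?_))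
  ring

/-- The extremal inequality for the averaged kernels. -/
lemma integral_pascuAvg_le_re {lam : ℝ → ℝ} (hl : ∀ t ∈ Ioo (0 : ℝ) 1, 0 ≤ lam t)
    (hi : IntervalIntegrable lam volume 0 1) {ξ p q : ℝ} (hp : 0 ≤ p) (hξ : 0 ≤ ξ) (hq : 0 < q)
    (hξq : ξ ≤ q) (H : HasGapProperty lam p) {x z : ℂ} (hx : ‖x‖ ≤ 1) (hz : ‖z‖ < 1) :
    ∫ t in (0 : ℝ)..1, lam t * pascuAvg ξ p q (fun u => 1 / (1 + u) ^ 2) t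
      ≤ (∫ t in (0 : ℝ)..1, (lam t : ℂ) * pascuAvg ξ p q (starKernel x z) t).re := by
  obtain ⟨c, hc, hcz⟩ := kernelGap_add_le_re_starKernel hx hz
  have hk := continuousOn_starKernel x hz
  have hS := continuousOn_pascuAvg (ξ := ξ) hp hq.le hk
  have hg := continuousOn_kernelGap_mul hc (norm_nonneg z) hz
  have hθ := continuousOn_one_div_one_add_sq
  have hre : (∫ t in (0 : ℝ)..1, (lam t : ℂ) * pascuAvg ξ p q (starKernel x z) t).re
      = ∫ t in (0 : ℝ)..1, lam t * pascuAvg ξ p q (fun u => (starKernel x z u).re) t := by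
    have hint : IntervalIntegrable (fun t => (lam t : ℂ) * pascuAvg ξ p q (starKernel x z) t)
        volume 0 1 := by
      refine IntervalIntegrable.mul_continuousOn ?_ (by rwa [uIcc_of_le zero_le_one])
      exact ⟨hi.1.ofReal, hi.2.ofReal⟩
    rw [← Complex.reCLM_apply, ← Complex.reCLM.intervalIntegral_comp_comm hint]
    refine intervalIntegral.integral_congr fun t ht => ?_
    rw [uIcc_of_le zero_le_one] at ht
    have := pascuAvg_clm (ξ := ξ) Complex.reCLM hp hq.le hk ht
    simp only [Complex.reCLM_apply] at this ⊢
    rw [this, Complex.re_ofReal_mul]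
  have hB := integral_mul_pascuAvg_kernelGap_nonneg hi hp hξ hq hξq H hc (norm_nonneg z) hz
  have hSg := intervalIntegrable_mul_of_continuousOn hi (continuousOn_pascuAvg (ξ := ξ) hp hq.le hg)
  have hSθ := intervalIntegrable_mul_of_continuousOn hi (continuousOn_pascuAvg (ξ := ξ) hp hq.le hθ)
  have hkre : ContinuousOn (fun u => (starKernel x z u).re) (Icc 0 1) :=
    Complex.continuous_re.comp_continuousOn hk
  have hSk := intervalIntegrable_mul_of_continuousOn hi
    (continuousOn_pascuAvg (ξ := ξ) hp hq.le hkre)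
  have hmono := intervalIntegral.integral_mono_on_of_le_Ioo zero_le_one (hSg.add hSθ) hSk
    fun t ht => by
      have ht' : t ∈ Icc (0 : ℝ) 1 := ⟨ht.1.le, ht.2.le⟩
      rw [← mul_add, ← pascuAvg_add hp hq.le hg hθ ht']
      exact mul_le_mul_of_nonneg_left (pascuAvg_mono hp hξ hq hξq (hg.add hθ) hkre hcz ht')
        (hl t ht)
  rw [intervalIntegral.integral_add hSg hSθ] at hmono
  rw [hre]
  linarith

/-- The function `1/(1 + t)²` is the extremal kernel for `x = 1` at the point `-t`, so the general
series applies. -/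
lemma hasSum_pascuAvg_one_div {ξ p q : ℝ} (hp : 0 ≤ p) (hq : 0 < q) {t : ℝ}
    (ht : t ∈ Ico (0 : ℝ) 1) :
    HasSum (fun n : ℕ => ((1 + ξ * n) * (n + 1) * (-1) ^ n * t ^ n) / ((1 + p * n) * (1 + q * n)))
      (pascuAvg ξ p q (fun u : ℝ => 1 / (1 + u) ^ 2) t) := by
  have h : ∀ t ∈ Ico (0 : ℝ) 1, HasSum (fun n : ℕ => ((n + 1) * (-1) ^ n : ℂ) * (t : ℂ) ^ n)
      (((1 / (1 + t) ^ 2 : ℝ) : ℂ)) := fun t ht => by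
    have := hasSum_starKernel 1 (w := -(t : ℂ)) (by
      rw [norm_neg, Complex.norm_real, Real.norm_of_nonneg ht.1]; exact ht.2)
    convert this using 1
    · ext n
      rw [neg_pow (t : ℂ)]
      ring
    · push_cast
      ring
  have h2 := hasSum_pascuAvg (ξ := ξ) hp hq h ht
  have e : pascuAvg ξ p q (fun u : ℝ => ((1 / (1 + u) ^ 2 : ℝ) : ℂ)) t
      = ((pascuAvg ξ p q (fun u : ℝ => 1 / (1 + u) ^ 2) t : ℝ) : ℂ) := by
    simp only [pascuAvg, powerAvg, intervalIntegral.integral_ofReal, Complex.real_smul, smul_eq_mul]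
    push_cast
    rfl
  rw [e] at h2
  rw [← Complex.hasSum_ofReal]
  convert h2 using 1
  ext n
  push_cast
  ring

/-- The condition on `β` in terms of the averaged kernel. -/
lemma BetaCondition.integral_pascuAvg {lam : ℝ → ℝ} (hw : IsWeight lam) {μ ν p q ξ ρ β : ℝ}
    (hp : 0 < p) (hq : 0 < q) (hpq : (μ = p ∧ ν = q) ∨ (μ = q ∧ ν = p))
    (hβ : BetaCondition lam μ ν ξ ρ β) :
    ∫ t in (0 : ℝ)..1, lam t * pascuAvg ξ p q (fun u => 1 / (1 + u) ^ 2) t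
      = 1 - 1 / (2 * (1 - β) * (1 - ρ)) := by
  have hden : ∀ n : ℕ, (1 + μ * n) * (1 + ν * n) = (1 + p * n) * (1 + q * n) := by
    intro n
    rcases hpq with ⟨rfl, rfl⟩ | ⟨rfl, rfl⟩
    · rfl
    · ring
  have hpt : ∀ t ∈ Ioo (0 : ℝ) 1,
      lam t * ((1 - ξ) * ((1 - gFun μ ν t) / 2) + ξ * (1 - qFun μ ν t))
        = lam t - lam t * pascuAvg ξ p q (fun u => 1 / (1 + u) ^ 2) t := by
    intro t ht
    have ht' : t ∈ Ico (0 : ℝ) 1 := ⟨ht.1.le, ht.2⟩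
    -- `gFun` and `qFun` come from the averages with `ξ = 0` and `ξ = 1`, and `pascuAvg` is affine
    -- in `ξ`.
    have h0 := (hasSum_pascuAvg_one_div (ξ := 0) hp.le hq ht').tsum_eq
    have h1 := (hasSum_pascuAvg_one_div (ξ := 1) hp.le hq ht').tsum_eq
    have hg : gFun μ ν t = 2 * pascuAvg 0 p q (fun u => 1 / (1 + u) ^ 2) t - 1 := by
      rw [← h0, gFun]
      simp only [hden, zero_mul, add_zero, one_mul]
    have hqf : qFun μ ν t = pascuAvg 1 p q (fun u => 1 / (1 + u) ^ 2) t := by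
      rw [← h1, qFun]
      refine tsum_congr fun n => ?_
      rw [hden]
      ring
    rw [hg, hqf]
    simp only [pascuAvg, smul_eq_mul]
    ring
  have hint := intervalIntegrable_mul_of_continuousOn hw.integrable
    (continuousOn_pascuAvg (ξ := ξ) hp.le hq.le continuousOn_one_div_one_add_sq)
  unfold BetaCondition at hβ
  rw [intervalIntegral.integral_congr_Ioo_of_le zero_le_one hpt,
    intervalIntegral.integral_sub hw.integrable hint, hw.integral_eq_one] at hβ
  linarith

/-! ### Moments and power series in the disc -/

/-- Moments of a weight, as complex numbers. -/
noncomputable def moment (lam : ℝ → ℝ) (n : ℕ) : ℂ := ((∫ t in (0 : ℝ)..1, lam t * t ^ n : ℝ) : ℂ)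

lemma hasSum_integral_mul {lam : ℝ → ℝ} (hi : IntervalIntegrable lam volume 0 1) {a : ℕ → ℂ}
    (ha : Summable fun n => ‖a n‖) {g : ℝ → ℂ}
    (h : ∀ t ∈ Ioo (0 : ℝ) 1, HasSum (fun n => a n * (t : ℂ) ^ n) (g t)) :
    HasSum (fun n => a n * moment lam n) (∫ t in (0 : ℝ)..1, (lam t : ℂ) * g t) := by
  have hmem : ∀ᵐ t : ℝ, t ∈ uIoc (0 : ℝ) 1 → t ∈ Ioo (0 : ℝ) 1 := by
    filter_upwards [Measure.ae_ne volume (1 : ℝ)] with t ht h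
    rw [uIoc_of_le zero_le_one] at h
    exact ⟨h.1, lt_of_le_of_ne h.2 ht⟩
  have hiC : IntervalIntegrable (fun t => (lam t : ℂ)) volume 0 1 := ⟨hi.1.ofReal, hi.2.ofReal⟩
  have key := intervalIntegral.hasSum_integral_of_dominated_convergence (μ := volume)
    (a := (0 : ℝ)) (b := 1) (F := fun n t => (lam t : ℂ) * (a n * (t : ℂ) ^ n))
    (f := fun t => (lam t : ℂ) * g t) (fun n t => ‖lam t‖ * ‖a n‖) (fun n => ?_) (fun n => ?_)
    ?_ ?_ ?_
  · refine key.congr_fun fun n => ?_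
    rw [moment, ← intervalIntegral.integral_ofReal, ← intervalIntegral.integral_const_mul]
    refine intervalIntegral.integral_congr fun t _ => ?_
    push_cast
    ring
  · rw [uIoc_of_le zero_le_one]
    have hc : Continuous fun t : ℝ => a n * (t : ℂ) ^ n := by fun_prop
    exact hiC.1.aestronglyMeasurable.mul hc.aestronglyMeasurable
  · filter_upwards [hmem] with t ht h
    have := ht h
    rw [norm_mul, norm_mul, norm_pow, Complex.norm_real, Complex.norm_real,
      Real.norm_of_nonneg this.1.le]
    exact mul_le_mul_of_nonneg_left (mul_le_of_le_one_right (norm_nonneg _)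
      (pow_le_one₀ this.1.le this.2.le)) (norm_nonneg _)
  · exact Filter.Eventually.of_forall fun t _ => ha.mul_left _
  · simp only [tsum_mul_left]
    exact hi.norm.mul_const _
  · filter_upwards [hmem] with t ht h'
    exact (h t (ht h')).mul_left _

/-- `F` is the sum of the power series with coefficients `a` in the unit disc. -/
def HasDiscSeries (a : ℕ → ℂ) (F : ℂ → ℂ) : Prop :=
  ∀ z ∈ unitDisc, HasSum (fun n => a n * z ^ n) (F z)

lemma mem_unitDisc {z : ℂ} : z ∈ unitDisc ↔ ‖z‖ < 1 := by simp [unitDisc]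

lemma isOpen_unitDisc : IsOpen unitDisc := Metric.isOpen_ball

lemma hasDiscSeries_taylorCoeff {f : ℂ → ℂ} (hf : DifferentiableOn ℂ f unitDisc) :
    HasDiscSeries (taylorCoeff f) f := fun z hz => by
  refine (Complex.hasSum_taylorSeries_on_ball hf hz).congr_fun fun n => ?_
  simp only [taylorCoeff, sub_zero, smul_eq_mul]
  ring

namespace HasDiscSeries

variable {a b : ℕ → ℂ} {F G : ℂ → ℂ}

lemma hasFPowerSeriesOnBall (h : HasDiscSeries a F) :
    HasFPowerSeriesOnBall F (FormalMultilinearSeries.ofScalars ℂ a) 0 1 where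
  r_le := by
    refine ENNReal.le_of_forall_nnreal_lt fun r hr => ?_
    refine FormalMultilinearSeries.le_radius_of_summable_norm _ ?_
    have hr1 : (r : ℝ) < 1 := by exact_mod_cast hr
    have := (h (r : ℝ) (by simpa [mem_unitDisc] using hr1)).summable.norm
    refine this.congr fun n => ?_
    rw [FormalMultilinearSeries.ofScalars_norm]
    simp
  r_pos := one_pos
  hasSum := by
    intro y hy
    have hy' : y ∈ unitDisc := by
      have := hy
      rw [← ENNReal.coe_one, Metric.eball_coe] at this
      exact this
    simpa [FormalMultilinearSeries.ofScalars_apply_eq, mul_comm] using h y hy'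

lemma differentiableOn (h : HasDiscSeries a F) : DifferentiableOn ℂ F unitDisc := by
  have := h.hasFPowerSeriesOnBall.differentiableOn
  rwa [← ENNReal.coe_one, Metric.eball_coe] at this

lemma taylorCoeff_eq (h : HasDiscSeries a F) (n : ℕ) : taylorCoeff F n = a n := by
  have h1 := h.hasFPowerSeriesOnBall.hasFPowerSeriesAt
  have h2 := h1.analyticAt.hasFPowerSeriesAt
  have := congrArg (fun p => p.coeff n) (h2.eq_formalMultilinearSeries h1)
  simp only [FormalMultilinearSeries.coeff_ofScalars] at this
  exact this

lemma apply_zero (h : HasDiscSeries a F) : F 0 = a 0 := by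
  rw [← h.taylorCoeff_eq 0]
  simp [taylorCoeff]

lemma deriv (h : HasDiscSeries a F) :
    HasDiscSeries (fun n => (n + 1) * a (n + 1)) (deriv F) := fun z hz => by
  refine (hasDiscSeries_taylorCoeff (h.differentiableOn.deriv isOpen_unitDisc) z hz).congr_fun
    fun n => ?_
  simp only
  rw [← h.taylorCoeff_eq, taylorCoeff, taylorCoeff, iteratedDeriv_succ', Nat.factorial_succ]
  have := Nat.factorial_ne_zero n
  push_cast
  field_simp

lemma deriv_zero (h : HasDiscSeries a F) : _root_.deriv F 0 = a 1 := by
  simpa using h.deriv.apply_zero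

lemma mul_id (h : HasDiscSeries a F) (h0 : b 0 = 0) (hb : ∀ n, b (n + 1) = a n) :
    HasDiscSeries b fun z => z * F z := fun z hz => by
  have := ((h z hz).mul_left z)
  have h2 : HasSum (fun n => b (n + 1) * z ^ (n + 1)) (z * F z) :=
    this.congr_fun fun n => by rw [hb]; ring
  rw [hasSum_nat_add_iff (f := fun n => b n * z ^ n) 1] at h2
  simpa [h0] using h2

lemma dslope (h : HasDiscSeries a F) (h0 : a 0 = 0) :
    HasDiscSeries (fun n => a (n + 1)) (dslope F 0) := fun z hz => by
  rcases eq_or_ne z 0 with rfl | hne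
  · rw [dslope_same, h.deriv_zero]
    have := hasSum_single (f := fun n => a (n + 1) * (0 : ℂ) ^ n) 0 fun n hn => by simp [hn]
    simpa using this
  · rw [dslope_of_ne _ hne, slope_def_field, h.apply_zero, h0, sub_zero, sub_zero]
    have h2 := (hasSum_nat_add_iff (f := fun n => a n * z ^ n) (g := F z) 1).mpr
      (by simpa [h0] using h z hz)
    refine (h2.div_const z).congr_fun fun n => ?_
    rw [pow_succ]
    field_simp

lemma add (h : HasDiscSeries a F) (h' : HasDiscSeries b G) :
    HasDiscSeries (fun n => a n + b n) fun z => F z + G z := fun z hz =>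
  ((h z hz).add (h' z hz)).congr_fun fun n => by ring

lemma const_mul (h : HasDiscSeries a F) (c : ℂ) :
    HasDiscSeries (fun n => c * a n) fun z => c * F z := fun z hz =>
  ((h z hz).mul_left c).congr_fun fun n => by ring

lemma add_const (h : HasDiscSeries a F) (c : ℂ) :
    HasDiscSeries (fun n => a n + if n = 0 then c else 0) fun z => F z + c := fun z hz => by
  have h2 : HasSum (fun n : ℕ => if n = 0 then c else 0) c := hasSum_ite_eq 0 c
  refine ((h z hz).add h2).congr_fun fun n => ?_
  rcases eq_or_ne n 0 with rfl | hn <;> simp [*]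

lemma summable_norm (h : HasDiscSeries a F) {r : ℝ} (hr : 0 ≤ r) (hr1 : r < 1) :
    Summable fun n => ‖a n‖ * r ^ n := by
  have := (h (r : ℂ) (by simpa [mem_unitDisc, abs_of_nonneg hr] using hr1)).summable.norm
  simpa [abs_of_nonneg hr] using this

/-- With `‖z‖ = r²`, `r < 1`, the factor `r²ⁿ` is shared out as `rⁿ` to each of the two absolutely
convergent series. -/
lemma hadamard (h : HasDiscSeries a F) (h' : HasDiscSeries b G) :
    HasDiscSeries (fun n => a n * b n) (hadamard F G) := fun z hz => by
  set r := Real.sqrt ‖z‖ with hr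
  have hr0 : 0 ≤ r := Real.sqrt_nonneg _
  have hr1 : r < 1 := by
    rw [hr, Real.sqrt_lt' one_pos]
    simpa using mem_unitDisc.mp hz
  have hrz : r * r = ‖z‖ := Real.mul_self_sqrt (norm_nonneg z)
  have ha := h.summable_norm hr0 hr1
  have hb := h'.summable_norm hr0 hr1
  have hsum : Summable fun n => a n * b n * z ^ n := by
    refine Summable.of_norm (Summable.of_nonneg_of_le (fun n => norm_nonneg _) (fun n => ?_)
      (hb.mul_left (∑' n, ‖a n‖ * r ^ n)))
    have h1 : ‖a n‖ * r ^ n ≤ ∑' n, ‖a n‖ * r ^ n :=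
      ha.le_tsum n fun m _ => by positivity
    calc ‖a n * b n * z ^ n‖ = ‖a n‖ * r ^ n * (‖b n‖ * r ^ n) := by
          rw [norm_mul, norm_mul, norm_pow, ← hrz, mul_pow]
          ring
      _ ≤ _ := mul_le_mul_of_nonneg_right h1 (by positivity)
  have e : PascuClass.hadamard F G z = ∑' n, a n * b n * z ^ n := by
    simp only [PascuClass.hadamard, h.taylorCoeff_eq, h'.taylorCoeff_eq]
  rw [e]
  exact hsum.hasSum

end HasDiscSeries

/-! ### Circle means, half-planes and duality -/

lemma integral_exp_int_mul (k : ℤ) :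
    ∫ θ in (0 : ℝ)..2 * π, Complex.exp (k * θ * Complex.I) = if k = 0 then (2 * π : ℂ) else 0 := by
  rcases eq_or_ne k 0 with rfl | hk
  · simp
  · have hc : (k * Complex.I : ℂ) ≠ 0 := mul_ne_zero (by exact_mod_cast hk) Complex.I_ne_zero
    have := integral_exp_mul_complex (a := 0) (b := 2 * π) hc
    rw [if_neg hk]
    calc _ = ∫ θ in (0 : ℝ)..2 * π, Complex.exp (k * Complex.I * θ) := by
          refine intervalIntegral.integral_congr fun θ _ => ?_
          ring_nf
      _ = 0 := by
          rw [this, div_eq_zero_iff]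
          left
          have : (k * Complex.I * ((2 * π : ℝ) : ℂ)) = k * (2 * π * Complex.I) := by
            push_cast; ring
          rw [this, Complex.exp_int_mul_two_pi_mul_I]
          simp

lemma hasSum_integral_mul_exp {u v : ℝ → ℂ} (hu : Continuous u) {b : ℕ → ℂ} {k : ℕ → ℤ}
    (hb : Summable fun n => ‖b n‖)
    (hv : ∀ θ : ℝ, HasSum (fun n => b n * Complex.exp (k n * θ * Complex.I)) (v θ)) :
    HasSum (fun n => b n * ∫ θ in (0 : ℝ)..2 * π, u θ * Complex.exp (k n * θ * Complex.I))
      (∫ θ in (0 : ℝ)..2 * π, u θ * v θ) := by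
  have key := intervalIntegral.hasSum_integral_of_dominated_convergence (μ := volume)
    (a := (0 : ℝ)) (b := 2 * π)
    (F := fun n (θ : ℝ) => u θ * (b n * Complex.exp (k n * θ * Complex.I)))
    (f := fun θ => u θ * v θ) (fun n θ => ‖u θ‖ * ‖b n‖) (fun n => ?_) (fun n => ?_) ?_ ?_ ?_
  · refine key.congr_fun fun n => ?_
    rw [← intervalIntegral.integral_const_mul]
    refine intervalIntegral.integral_congr fun θ _ => ?_
    ring
  · exact Continuous.aestronglyMeasurable (by fun_prop)
  · refine Filter.Eventually.of_forall fun θ _ => ?_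
    have : ‖Complex.exp (k n * θ * Complex.I)‖ = 1 := by
      have := Complex.norm_exp_ofReal_mul_I (k n * θ)
      push_cast at this
      exact this
    rw [norm_mul, norm_mul, this, mul_one]
  · exact Filter.Eventually.of_forall fun θ _ => hb.mul_left _
  · simp only [tsum_mul_left]
    exact Continuous.intervalIntegrable (by fun_prop) _ _
  · exact Filter.Eventually.of_forall fun θ _ => (hv θ).mul_left _

lemma integral_mul_exp_neg {u : ℝ → ℂ} {a : ℕ → ℂ} (ha : Summable fun n => ‖a n‖)
    (hu : ∀ θ : ℝ, HasSum (fun n : ℕ => a n * Complex.exp (((n : ℤ) : ℂ) * θ * Complex.I)) (u θ))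
    (k : ℤ) :
    ∫ θ in (0 : ℝ)..2 * π, u θ * Complex.exp (-k * θ * Complex.I)
      = ∑' n : ℕ, a n * if (n : ℤ) = k then (2 * π : ℂ) else 0 := by
  have h := hasSum_integral_mul_exp (u := fun θ => Complex.exp (-k * θ * Complex.I))
    (by fun_prop) (k := fun n => (n : ℤ)) ha hu
  have e : ∀ n : ℕ, ∫ θ in (0 : ℝ)..2 * π, Complex.exp (-k * θ * Complex.I) *
      Complex.exp (((n : ℤ) : ℂ) * θ * Complex.I) = if (n : ℤ) = k then (2 * π : ℂ) else 0 := fun n => by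
    have := integral_exp_int_mul (n - k)
    simp only [sub_eq_zero] at this
    rw [← this]
    refine intervalIntegral.integral_congr fun θ _ => ?_
    rw [← Complex.exp_add]
    push_cast
    ring_nf
  rw [show (∫ θ in (0 : ℝ)..2 * π, u θ * Complex.exp (-k * θ * Complex.I))
    = ∫ θ in (0 : ℝ)..2 * π, Complex.exp (-k * θ * Complex.I) * u θ by simp only [mul_comm],
    ← h.tsum_eq]
  refine tsum_congr fun n => ?_
  rw [e]

/-- Circle means against `2 Re v - 1` compute the Hadamard product. -/
lemma hasSum_circle_mean {u v : ℝ → ℂ} {a b : ℕ → ℂ} (hu : Continuous u) (hv : Continuous v)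
    (ha : Summable fun n => ‖a n‖) (hb : Summable fun n => ‖b n‖) (hb0 : b 0 = 1)
    (hua : ∀ θ : ℝ, HasSum (fun n : ℕ => a n * Complex.exp (((n : ℤ) : ℂ) * θ * Complex.I)) (u θ))
    (hvb : ∀ θ : ℝ, HasSum (fun n : ℕ => b n * Complex.exp (((-n : ℤ) : ℂ) * θ * Complex.I))
      (v θ)) :
    HasSum (fun n => a n * b n)
      ((2 * π : ℂ)⁻¹ * ∫ θ in (0 : ℝ)..2 * π, u θ * ((2 * (v θ).re - 1 : ℝ) : ℂ)) := by
  have hpi : (2 * π : ℂ) ≠ 0 := by exact_mod_cast Real.two_pi_pos.ne'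
  have hcoef : ∀ m : ℕ, ∫ θ in (0 : ℝ)..2 * π, u θ * Complex.exp (((-m : ℤ) : ℂ) * θ * Complex.I)
      = 2 * π * a m := fun m => by
    have := integral_mul_exp_neg ha hua m
    push_cast at this ⊢
    rw [this, tsum_eq_single m fun n hn => by rw [if_neg (by exact_mod_cast hn), mul_zero]]
    simp [mul_comm]
  have hcoef' : ∀ m : ℕ, ∫ θ in (0 : ℝ)..2 * π, u θ * Complex.exp (((m : ℤ) : ℂ) * θ * Complex.I)
      = if m = 0 then 2 * π * a 0 else 0 := fun m => by
    rcases eq_or_ne m 0 with rfl | hm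
    · simpa using hcoef 0
    · have := integral_mul_exp_neg ha hua (-m)
      rw [if_neg hm]
      push_cast at this ⊢
      rw [neg_neg] at this
      rw [this]
      refine (tsum_congr fun n => ?_).trans tsum_zero
      rw [if_neg (by omega), mul_zero]
  have h1 := hasSum_integral_mul_exp (k := fun n => -(n : ℤ)) hu hb hvb
  have hvb' : ∀ θ : ℝ, HasSum (fun n : ℕ => (starRingEnd ℂ) (b n) *
      Complex.exp (((n : ℤ) : ℂ) * θ * Complex.I)) ((starRingEnd ℂ) (v θ)) := fun θ => by
    refine ((hvb θ).map (starRingEnd ℂ) Complex.continuous_conj).congr_fun fun n => ?_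
    simp only [Function.comp, map_mul, ← Complex.exp_conj, Complex.conj_I, Complex.conj_ofReal,
      map_intCast]
    push_cast
    ring_nf
  have h2 := hasSum_integral_mul_exp (k := fun n => (n : ℤ)) hu
    (b := fun n => (starRingEnd ℂ) (b n)) (by simpa using hb) hvb'
  -- Both `u` and the conjugate of `v` have only non-negative frequencies, so just the constant
  -- terms meet. This contribution cancels the integral of `u` in `hsplit`.
  have h2' : ∫ θ in (0 : ℝ)..2 * π, u θ * (starRingEnd ℂ) (v θ) = 2 * π * a 0 := by
    rw [← h2.tsum_eq, tsum_eq_single 0 fun n hn => by rw [hcoef', if_neg hn, mul_zero]]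
    rw [hcoef', if_pos rfl, hb0]
    simp
  have h3 : ∫ θ in (0 : ℝ)..2 * π, u θ = 2 * π * a 0 := by simpa using hcoef 0
  have hsplit : ∫ θ in (0 : ℝ)..2 * π, u θ * ((2 * (v θ).re - 1 : ℝ) : ℂ)
      = ∫ θ in (0 : ℝ)..2 * π, u θ * v θ := by
    have e : ∀ θ, u θ * ((2 * (v θ).re - 1 : ℝ) : ℂ)
        = u θ * v θ + u θ * (starRingEnd ℂ) (v θ) - u θ := fun θ => by
      have := Complex.add_conj (v θ)
      push_cast at this ⊢
      linear_combination -(u θ) * this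
    have hc1 : Continuous fun θ => u θ * v θ := hu.mul hv
    have hc2 : Continuous fun θ => u θ * (starRingEnd ℂ) (v θ) :=
      hu.mul (Complex.continuous_conj.comp hv)
    have hc3 : Continuous fun θ => u θ * v θ + u θ * (starRingEnd ℂ) (v θ) := hc1.add hc2
    simp only [e]
    rw [intervalIntegral.integral_sub (hc3.intervalIntegrable _ _)
      (hu.intervalIntegrable _ _), intervalIntegral.integral_add (hc1.intervalIntegrable _ _)
      (hc2.intervalIntegrable _ _), h2', h3]
    ring
  rw [hsplit]
  refine (h1.mul_left (2 * π : ℂ)⁻¹).congr_fun fun n => ?_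
  rw [hcoef]
  field_simp

/-- Convolution with functions of real part at least `1 / 2` preserves half-planes. -/
lemma HasDiscSeries.re_mul_hadamard_pos {a b : ℕ → ℂ} {H P : ℂ → ℂ} {w : ℂ}
    (hH : HasDiscSeries a H) (hP : HasDiscSeries b P) (hb0 : b 0 = 1)
    (hpos : ∀ z ∈ unitDisc, 0 < (w * H z).re) (hhalf : ∀ z ∈ unitDisc, 1 / 2 ≤ (P z).re)
    {z S : ℂ} (hz : z ∈ unitDisc) (hS : HasSum (fun n => a n * b n * z ^ n) S) :
    0 < (w * S).re := by
  have hz1 := mem_unitDisc.mp hz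
  -- The factorization `z = (z/s) s` with `‖z‖ < s < 1` places both circles inside the disc.
  obtain ⟨s, hzs, hs1⟩ := exists_between hz1
  have hs0 : 0 < s := (norm_nonneg z).trans_lt hzs
  have hsC : (s : ℂ) ≠ 0 := by exact_mod_cast hs0.ne'
  have hz' : ‖z / s‖ < 1 := by
    rw [norm_div, Complex.norm_real, Real.norm_of_nonneg hs0.le, div_lt_one hs0]
    exact hzs
  have hexp : ∀ θ : ℝ, ‖Complex.exp (θ * Complex.I)‖ = 1 := Complex.norm_exp_ofReal_mul_I
  have hmu : ∀ θ : ℝ, z / s * Complex.exp (θ * Complex.I) ∈ unitDisc := fun θ => by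
    rw [mem_unitDisc, norm_mul, hexp, mul_one]
    exact hz'
  have hmv : ∀ θ : ℝ, s * Complex.exp (-θ * Complex.I) ∈ unitDisc := fun θ => by
    have := hexp (-θ)
    push_cast at this
    rw [mem_unitDisc, norm_mul, this, mul_one, Complex.norm_real, Real.norm_of_nonneg hs0.le]
    exact hs1
  set u : ℝ → ℂ := fun θ => H (z / s * Complex.exp (θ * Complex.I))
  set v : ℝ → ℂ := fun θ => P (s * Complex.exp (-θ * Complex.I))
  have hu : Continuous u := hH.differentiableOn.continuousOn.comp_continuous (by fun_prop) hmu
  have hv : Continuous v := hP.differentiableOn.continuousOn.comp_continuous (by fun_prop) hmv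
  have hb : Summable fun n => ‖b n * (s : ℂ) ^ n‖ :=
    (hP s (by simpa [mem_unitDisc, abs_of_pos hs0] using hs1)).summable.norm
  have hb0' : b 0 * (s : ℂ) ^ 0 = 1 := by simp [hb0]
  have hvb : ∀ θ : ℝ, HasSum (fun n : ℕ => b n * (s : ℂ) ^ n *
      Complex.exp (((-n : ℤ) : ℂ) * θ * Complex.I)) (v θ) := fun θ =>
    (hP _ (hmv θ)).congr_fun fun n => by
      rw [mul_pow, ← Complex.exp_nat_mul]
      push_cast
      ring_nf
  have hmean := hasSum_circle_mean hu hv (hH _ (mem_unitDisc.mpr hz')).summable.norm hb hb0'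
    (fun θ => (hH _ (hmu θ)).congr_fun fun n => by
      rw [mul_pow, ← Complex.exp_nat_mul]
      push_cast
      ring_nf) hvb
  have hS' := hmean.unique (hS.congr_fun fun n => by
    rw [div_pow]
    field_simp)
  -- The mean formula for the constant 1 shows that the non-negative weight `2 Re v - 1` has mean
  -- one; hence `S` is an average of values of `H` on a circle.
  have hone := hasSum_circle_mean (u := fun _ => 1) (a := fun n => if n = 0 then 1 else 0)
    continuous_const hv ((hasSum_ite_eq 0 (1 : ℂ)).summable.norm) hb hb0'
    (fun θ => by
      refine (hasSum_ite_eq 0 (1 : ℂ)).congr_fun fun n => ?_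
      rcases eq_or_ne n 0 with rfl | hn <;> simp [*]) hvb
  have hone' := hone.unique ((hasSum_ite_eq 0 (1 : ℂ)).congr_fun fun n => by
    rcases eq_or_ne n 0 with rfl | hn <;> simp [*])
  set W : ℝ → ℝ := fun θ => 2 * (v θ).re - 1
  have hW : Continuous W := by
    have := Complex.continuous_re.comp hv
    exact (continuous_const.mul this).sub continuous_const
  have hW0 : ∀ θ, 0 ≤ W θ := fun θ => by
    have := hhalf _ (hmv θ)
    simp only [W, v]
    linarith
  have hpi : (2 * π : ℂ) ≠ 0 := by exact_mod_cast Real.two_pi_pos.ne'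
  have hWint : ∫ θ in (0 : ℝ)..2 * π, W θ = 2 * π := by
    simp only [one_mul] at hone'
    rw [intervalIntegral.integral_ofReal, inv_mul_eq_iff_eq_mul₀ hpi, mul_one] at hone'
    exact_mod_cast hone'
  rw [inv_mul_eq_iff_eq_mul₀ hpi] at hS'
  have hg : Continuous fun θ => (w * u θ).re := Complex.continuous_re.comp (continuous_const.mul hu)
  -- The minimum over the compact circle is attained, which keeps the inequality strict.
  obtain ⟨θ₀, -, hmin⟩ := isCompact_Icc.exists_isMinOn
    (nonempty_Icc.mpr Real.two_pi_pos.le) hg.continuousOn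
  have hm : 0 < (w * u θ₀).re := hpos _ (hmu θ₀)
  have hmono : ∫ θ in (0 : ℝ)..2 * π, (w * u θ₀).re * W θ
      ≤ ∫ θ in (0 : ℝ)..2 * π, (w * u θ).re * W θ :=
    intervalIntegral.integral_mono_on Real.two_pi_pos.le
      ((continuous_const.mul hW).intervalIntegrable _ _) ((hg.mul hW).intervalIntegrable _ _)
      fun θ hθ => mul_le_mul_of_nonneg_right (hmin hθ) (hW0 θ)
  rw [intervalIntegral.integral_const_mul, hWint] at hmono
  have hre : ∫ θ in (0 : ℝ)..2 * π, (w * u θ).re * W θ = (w * (2 * π * S)).re := by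
    have hc : Continuous fun θ => w * (u θ * (W θ : ℂ)) :=
      continuous_const.mul (hu.mul (Complex.continuous_ofReal.comp hW))
    rw [← hS', ← intervalIntegral.integral_const_mul, ← Complex.reCLM_apply,
      ← Complex.reCLM.intervalIntegral_comp_comm (hc.intervalIntegrable _ _)]
    refine intervalIntegral.integral_congr fun θ _ => ?_
    simp only [Complex.reCLM_apply]
    rw [← mul_assoc, Complex.re_mul_ofReal]
  have hre2 : (w * (2 * π * S)).re = 2 * π * (w * S).re := by
    rw [show w * (2 * π * S) = ((2 * π : ℝ) : ℂ) * (w * S) by push_cast; ring,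
      Complex.re_ofReal_mul]
  rw [hre, hre2] at hmono
  have := Real.two_pi_pos
  by_contra! hneg
  nlinarith

/-- If `(1 - x) / 2 * A + (1 + x) / 2 * B` stays in an open half-plane through the origin for all
`‖x‖ ≤ 1`, then `B / A` has positive real part. -/
lemma re_div_pos_of_forall {A B w : ℂ}
    (h : ∀ x : ℂ, ‖x‖ ≤ 1 → 0 < (w * ((1 - x) / 2 * A + (1 + x) / 2 * B)).re) : 0 < (B / A).re := by
  have hA : A ≠ 0 := by
    rintro rfl
    have := h (-1) (by simp)
    norm_num at this
  by_contra! hre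
  set v := B / A with hv
  have hB : B = v * A := by rw [hv, div_mul_cancel₀ _ hA]
  have hne : 1 - v ≠ 0 := by
    intro h0
    rw [← sub_eq_zero.mp h0] at hre
    norm_num at hre
  -- If `Re v ≤ 0`, the Cayley image of `v` is an admissible `x`, and for it the combination
  -- vanishes.
  have hx : ‖(1 + v) / (1 - v)‖ ≤ 1 := by
    rw [norm_div, div_le_one (norm_pos_iff.mpr hne)]
    refine le_of_sq_le_sq ?_ (norm_nonneg _)
    rw [Complex.sq_norm, Complex.sq_norm, Complex.normSq_apply, Complex.normSq_apply]
    simp only [Complex.add_re, Complex.sub_re, Complex.one_re, Complex.add_im, Complex.sub_im,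
      Complex.one_im]
    nlinarith
  have := h _ hx
  have e : (1 - (1 + v) / (1 - v)) / 2 * A + (1 + (1 + v) / (1 - v)) / 2 * B = 0 := by
    rw [hB]
    field_simp
    ring
  rw [e, mul_zero, Complex.zero_re] at this
  exact lt_irrefl _ this

/-! ### Membership in the Pascu class -/

lemma moment_zero {lam : ℝ → ℝ} (hw : IsWeight lam) : moment lam 0 = 1 := by
  simp [moment, hw.integral_eq_one]

/-- The power series of the kernel of `genOp`. -/
lemma hasDiscSeries_genOp_kernel {lam : ℝ → ℝ} (hi : IntervalIntegrable lam volume 0 1) (ρ : ℝ)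
    {b : ℕ → ℂ} (hb0 : b 0 = 0)
    (hb : ∀ n, b (n + 1) = ((1 - ρ) + if n = 0 then (ρ : ℂ) else 0) * moment lam n) :
    HasDiscSeries b
      fun z : ℂ => z * ∫ t in (0 : ℝ)..1, (lam t : ℂ) * ((1 - ρ * t * z) / (1 - t * z)) := by
  refine HasDiscSeries.mul_id (a := fun n => ((1 - ρ) + if n = 0 then (ρ : ℂ) else 0) * moment lam n)
    (fun z hz => ?_) hb0 hb
  have hser : HasDiscSeries (fun n => (1 - ρ) * 1 + if n = 0 then (ρ : ℂ) else 0)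
      fun z => (1 - ρ) * (1 - z)⁻¹ + ρ := by
    refine HasDiscSeries.add_const (HasDiscSeries.const_mul (fun z hz => ?_) _) _
    simpa using hasSum_geometric_of_norm_lt_one (mem_unitDisc.mp hz)
  have key := hasSum_integral_mul hi (hser z hz).summable.norm
    (g := fun t => (1 - ρ * t * z) / (1 - t * z)) fun t ht => by
      have hlt := norm_ofReal_mul_lt (mem_unitDisc.mp hz) ⟨ht.1.le, ht.2.le⟩
      have hne := one_sub_ne_zero_of_norm_lt hlt
      have e : (1 - ρ * t * z) / (1 - t * z) = (1 - ρ) * (1 - t * z)⁻¹ + ρ := by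
        field_simp
        ring
      rw [e]
      exact (hser _ (mem_unitDisc.mpr hlt)).congr_fun fun n => by ring
  exact key.congr_fun fun n => by ring

/-- The multiplier of the averaged extremal functions. -/
noncomputable def multiplier (ξ p q : ℝ) (n : ℕ) : ℂ :=
  (1 + ξ * n) / ((1 + p * n) * (1 + q * n))

lemma norm_multiplier_le {ξ p q : ℝ} (hp : 0 ≤ p) (hξ : 0 ≤ ξ) (hξq : ξ ≤ q) (n : ℕ) :
    ‖multiplier ξ p q n‖ ≤ 1 := by
  have hn : (0 : ℝ) ≤ n := Nat.cast_nonneg n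
  have e : multiplier ξ p q n = (((1 + ξ * n) / ((1 + p * n) * (1 + q * n)) : ℝ) : ℂ) := by
    unfold multiplier
    push_cast
    rfl
  have hq : 0 ≤ q := hξ.trans hξq
  rw [e, Complex.norm_real, Real.norm_of_nonneg (by positivity), div_le_one (by positivity)]
  have h1 : ξ * n ≤ q * n := mul_le_mul_of_nonneg_right hξq hn
  have h2 : 0 ≤ p * n * (1 + q * n) := by positivity
  linarith

/-- The power series of the averaged extremal functions. -/
lemma hasDiscSeries_integral_starKernel {lam : ℝ → ℝ} (hi : IntervalIntegrable lam volume 0 1)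
    {ξ p q : ℝ} (hp : 0 ≤ p) (hξ : 0 ≤ ξ) (hq : 0 < q) (hξq : ξ ≤ q) (x : ℂ) :
    HasDiscSeries (fun n => (1 + n * ((1 + x) / 2)) * multiplier ξ p q n * moment lam n)
      fun z => ∫ t in (0 : ℝ)..1, (lam t : ℂ) * pascuAvg ξ p q (starKernel x z) t := fun z hz => by
  have hz1 := mem_unitDisc.mp hz
  have hsum := (hasSum_starKernel x hz1).summable.norm
  have hsum' : Summable fun n : ℕ => ‖(1 + n * ((1 + x) / 2)) * z ^ n * multiplier ξ p q n‖ := by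
    refine Summable.of_nonneg_of_le (fun n => norm_nonneg _) (fun n => ?_) hsum
    rw [norm_mul _ (multiplier ξ p q n)]
    exact mul_le_of_le_one_right (norm_nonneg _) (norm_multiplier_le hp hξ hξq n)
  have key := hasSum_integral_mul hi hsum' (g := pascuAvg ξ p q (starKernel x z)) fun t ht => by
    refine hasSum_pascuAvg hp hq (a := fun n => (1 + n * ((1 + x) / 2)) * z ^ n) (fun t ht => ?_)
      ⟨ht.1.le, ht.2⟩
    exact (hasSum_starKernel x (norm_ofReal_mul_lt hz1 ⟨ht.1, ht.2.le⟩)).congr_fun fun n => by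
      rw [mul_pow]; ring
  exact key.congr_fun fun n => by ring

/-- The operator of `classW` in terms of Taylor coefficients. -/
lemma hasDiscSeries_classW {f : ℂ → ℂ} {a : ℕ → ℂ} (hf : HasDiscSeries a f) (ha0 : a 0 = 0)
    {α γ p q : ℝ} (hsum : p + q = α - γ) (hprod : p * q = γ) (β : ℝ) :
    HasDiscSeries
      (fun n => (1 + p * n) * (1 + q * n) * a (n + 1) + if n = 0 then (-β : ℂ) else 0)
      fun z => (1 - α + 2 * γ) * dslope f 0 z + (α - 2 * γ) * deriv f z
        + γ * z * deriv (deriv f) z - β := by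
  have h2 : HasDiscSeries (fun n => n * (n + 1) * a (n + 1)) fun z => z * deriv (deriv f) z :=
    hf.deriv.deriv.mul_id (by simp) fun n => by push_cast; ring
  have h := (((hf.dslope ha0).const_mul (1 - α + 2 * γ)).add
    (hf.deriv.const_mul (α - 2 * γ))).add (h2.const_mul γ) |>.add_const (-β)
  have hα : (α : ℂ) = p + q + p * q := by
    have : α = p + q + p * q := by linarith
    exact_mod_cast this
  have hγ : (γ : ℂ) = p * q := by exact_mod_cast hprod.symm
  intro z hz
  have := (h z hz).congr_fun (g := fun n => ((1 + p * n) * (1 + q * n) * a (n + 1) +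
    if n = 0 then (-β : ℂ) else 0) * z ^ n) fun n => by
      simp only
      rw [hα, hγ]
      ring
  convert this using 1
  ring

/-- Membership in the Pascu class from the extremal property of the weight. -/
theorem genOp_mem_pascu {α γ μ ν p q ξ ρ β : ℝ} {lam : ℝ → ℝ} (hp : 0 < p) (hq : 0 < q)
    (hpq : (μ = p ∧ ν = q) ∨ (μ = q ∧ ν = p)) (hsum : μ + ν = α - γ) (hprod : μ * ν = γ)
    (hξ : 0 ≤ ξ) (hξq : ξ ≤ q) (hρ : ρ < 1) (hβ : β < 1) (hw : IsWeight lam)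
    (hbeta : BetaCondition lam μ ν ξ ρ β) (H : HasGapProperty lam p) {f : ℂ → ℂ}
    (hf : f ∈ classW β α γ) : genOp lam ρ f ∈ pascu ξ := by
  obtain ⟨⟨hfd, hf0, hf1⟩, φ, hφ⟩ := hf
  have hsum' : p + q = α - γ := by
    rcases hpq with ⟨rfl, rfl⟩ | ⟨rfl, rfl⟩
    · exact hsum
    · rw [add_comm]; exact hsum
  have hprod' : p * q = γ := by
    rcases hpq with ⟨rfl, rfl⟩ | ⟨rfl, rfl⟩
    · exact hprod
    · rw [mul_comm]; exact hprod
  set a := taylorCoeff f with ha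
  have hfa : HasDiscSeries a f := hasDiscSeries_taylorCoeff hfd
  have ha0 : a 0 = 0 := by rw [← hfa.apply_zero, hf0]
  have ha1 : a 1 = 1 := by rw [← hfa.deriv_zero, hf1]
  -- The leading factor `z` shifts the index by one. The constant part `ρ` of `(1 - ρtz)/(1 - tz) =
  -- (1 - ρ)/(1 - tz) + ρ` affects only the first coefficient, which becomes 1.
  set κ : ℕ → ℂ := fun n => Nat.casesOn n 0
    fun n => ((1 - ρ) + if n = 0 then (ρ : ℂ) else 0) * moment lam n with hκ
  have hκs : ∀ n, κ (n + 1) = ((1 - ρ) + if n = 0 then (ρ : ℂ) else 0) * moment lam n :=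
    fun n => rfl
  have hker := hasDiscSeries_genOp_kernel hw.integrable ρ (b := κ) rfl hκs
  set e : ℕ → ℂ := fun n => κ n * a n with he
  have hF : HasDiscSeries e (genOp lam ρ f) := hker.hadamard hfa
  set F := genOp lam ρ f
  have he0 : e 0 = 0 := by simp [he, hκ]
  have he1 : e 1 = 1 := by
    have := hκs 0
    simp only [he, ha1, zero_add] at this ⊢
    rw [this, moment_zero hw]
    simp
  set k : ℕ → ℂ := fun n => ξ * (n * e n) + (1 - ξ) * e n with hk
  have hK : HasDiscSeries k fun z : ℂ => (ξ : ℂ) * z * deriv F z + (1 - (ξ : ℂ)) * F z := by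
    have h1 : HasDiscSeries (fun n => n * e n) fun z => z * deriv F z :=
      hF.deriv.mul_id (by simp) fun n => by push_cast; ring
    have := (h1.const_mul ξ).add (hF.const_mul (1 - ξ))
    simpa only [mul_assoc] using this
  have hk0 : k 0 = 0 := by simp [hk, he0]
  have hk1 : k 1 = 1 := by simp [hk, he1]
  refine ⟨⟨hF.differentiableOn, by rw [hF.apply_zero, he0], by rw [hF.deriv_zero, he1]⟩,
    ⟨hK.differentiableOn, hK.apply_zero.trans hk0, hK.deriv_zero.trans hk1⟩,
    fun z hz hz0 => ?_⟩
  set K : ℂ → ℂ := fun z => (ξ : ℂ) * z * deriv F z + (1 - (ξ : ℂ)) * F z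
  have hds : K z / z = dslope K 0 z := by
    rw [dslope_of_ne _ hz0, slope_def_field, hK.apply_zero, hk0, sub_zero, sub_zero]
  suffices h : 0 < (deriv K z / dslope K 0 z).re by
    rw [← hds] at h
    convert h using 2
    field_simp
  refine re_div_pos_of_forall (w := Complex.exp (Complex.I * φ)) fun x hx => ?_
  set T := (1 - x) / 2 * dslope K 0 z + (1 + x) / 2 * deriv K z
  have hT : HasSum (fun n : ℕ => k (n + 1) * (1 + n * ((1 + x) / 2)) * z ^ n) T :=
    ((((hK.dslope hk0).const_mul ((1 - x) / 2)).add (hK.deriv.const_mul ((1 + x) / 2)))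
      z hz).congr_fun fun n => by ring
  have hH := hasDiscSeries_classW hfa ha0 hsum' hprod' β
  have hβ1 : 0 < 1 - β := by linarith
  have hρ1 : 0 < 1 - ρ := by linarith
  set c : ℂ := (1 - β) * (1 - ρ) with hc
  have hP := ((hasDiscSeries_integral_starKernel hw.integrable hp.le hξ hq hξq x).const_mul
    c).add_const (1 - c)
  -- The linear factors of the multiplier cancel those produced by the operator of `classW`. At `n =
  -- 0` the constants `-β` and `1 - c` leave the coefficients `1 - β` and 1.
  have hmain := hH.re_mul_hadamard_pos hP (z := z) (S := (1 - β) * T)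
    (w := Complex.exp (Complex.I * φ)) ?_ hφ ?_ hz ?_
  · rw [show Complex.exp (Complex.I * φ) * ((1 - β) * T)
      = ((1 - β : ℝ) : ℂ) * (Complex.exp (Complex.I * φ) * T) by push_cast; ring,
      Complex.re_ofReal_mul] at hmain
    exact (mul_pos_iff_of_pos_left hβ1).mp hmain
  · simp [multiplier, moment_zero hw]
  · intro z hz
    have h1 := integral_pascuAvg_le_re hw.nonneg hw.integrable hp.le hξ hq hξq H hx
      (mem_unitDisc.mp hz)
    rw [hbeta.integral_pascuAvg hw hp hq hpq] at h1
    have hcr : c = (((1 - β) * (1 - ρ) : ℝ) : ℂ) := by rw [hc]; push_cast; rfl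
    have h2 : 0 < (1 - β) * (1 - ρ) := mul_pos hβ1 hρ1
    have h3 := mul_le_mul_of_nonneg_left h1 h2.le
    have h4 : (1 - β) * (1 - ρ) * (1 - 1 / (2 * (1 - β) * (1 - ρ)))
        = (1 - β) * (1 - ρ) - 1 / 2 := by
      field_simp
    rw [h4] at h3
    rw [hcr, Complex.add_re, Complex.re_ofReal_mul, Complex.sub_re, Complex.one_re,
      Complex.ofReal_re]
    linarith
  · refine (hT.mul_left (1 - β : ℂ)).congr_fun fun n => ?_
    rcases Nat.eq_zero_or_pos n with rfl | hn
    · simp [multiplier, moment_zero hw, ha1, hk1]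
      ring
    · have hn0 : n ≠ 0 := hn.ne'
      have e1 : (1 + p * n : ℂ) ≠ 0 := by exact_mod_cast (by positivity : (1 + p * n : ℝ) ≠ 0)
      have e2 : (1 + q * n : ℂ) ≠ 0 := by exact_mod_cast (by positivity : (1 + q * n : ℝ) ≠ 0)
      simp only [hk, he, hκs, if_neg hn0, multiplier, add_zero, hc]
      push_cast
      have : (1 + p * n) * (1 + q * n) * a (n + 1) *
          ((1 - β) * (1 - ρ) * ((1 + n * ((1 + x) / 2)) *
            ((1 + ξ * n) / ((1 + p * n) * (1 + q * n))) * moment lam n))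
          = a (n + 1) * ((1 - β) * (1 - ρ) * ((1 + n * ((1 + x) / 2)) *
            (1 + ξ * n) * moment lam n)) *
            (((1 + p * n) * (1 + q * n)) / ((1 + p * n) * (1 + q * n))) := by ring
      rw [this, div_self (mul_ne_zero e1 e2)]
      ring

/-! ### Monotonicity of the three families of weights -/

lemma antitoneOn_mul_of_nonneg {s : Set ℝ} {f g : ℝ → ℝ} (hf : AntitoneOn f s)
    (hg : AntitoneOn g s) (hf0 : ∀ t ∈ s, 0 ≤ f t) (hg0 : ∀ t ∈ s, 0 ≤ g t) :
    AntitoneOn (fun t => f t * g t) s := fun x hx y hy hxy =>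
  mul_le_mul (hf hx hy hxy) (hg hx hy hxy) (hg0 y hy) (hf0 x hx)

lemma antitoneOn_rpow_of_nonpos {e : ℝ} (he : e ≤ 0) :
    AntitoneOn (fun t : ℝ => t ^ e) (Ioo 0 1) := fun _ hx _ _ hxy =>
  Real.rpow_le_rpow_of_nonpos hx.1 hxy he

lemma antitoneOn_congr {s : Set ℝ} {f g : ℝ → ℝ} (h : EqOn f g s) (hg : AntitoneOn g s) :
    AntitoneOn f s := fun x hx y hy hxy => by
  rw [h hx, h hy]
  exact hg hx hy hxy

lemma one_sub_sq_pos {t : ℝ} (ht : t ∈ Ioo (0 : ℝ) 1) : 0 < 1 - t ^ 2 := by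
  nlinarith [ht.1, ht.2]

lemma log_one_div_pos {t : ℝ} (ht : t ∈ Ioo (0 : ℝ) 1) : 0 < Real.log (1 / t) :=
  Real.log_pos (by rw [lt_div_iff₀ ht.1]; linarith [ht.2])

/-- A quotient `u / (1 - t²)` decreases if `u' (1 - t²) + 2 t u ≤ 0`. -/
lemma antitoneOn_div_one_sub_sq {u u' : ℝ → ℝ} (hu : ∀ t ∈ Ioo (0 : ℝ) 1, HasDerivAt u (u' t) t)
    (h : ∀ t ∈ Ioo (0 : ℝ) 1, u' t * (1 - t ^ 2) + 2 * t * u t ≤ 0) :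
    AntitoneOn (fun t => u t / (1 - t ^ 2)) (Ioo 0 1) := by
  have hd : ∀ t ∈ Ioo (0 : ℝ) 1, HasDerivAt (fun t => u t / (1 - t ^ 2))
      ((u' t * (1 - t ^ 2) + 2 * t * u t) / (1 - t ^ 2) ^ 2) t := fun t ht => by
    refine ((hu t ht).div ((hasDerivAt_pow 2 t).const_sub 1) (one_sub_sq_pos ht).ne').congr_deriv ?_
    norm_num
    ring
  refine antitoneOn_of_deriv_nonpos (convex_Ioo 0 1)
    (fun t ht => (hd t ht).continuousAt.continuousWithinAt) (fun t ht => ?_) fun t ht => ?_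
  · rw [interior_Ioo] at ht
    exact (hd t ht).differentiableAt.differentiableWithinAt
  · rw [interior_Ioo] at ht
    rw [(hd t ht).deriv]
    exact div_nonpos_of_nonpos_of_nonneg (h t ht) (sq_nonneg _)

/-- The derivative criterion reduces to `log y ≤ y - 1` at `y = 1/t²`. -/
lemma antitoneOn_log_div : AntitoneOn (fun t => Real.log (1 / t) / (1 - t ^ 2)) (Ioo 0 1) := by
  refine antitoneOn_div_one_sub_sq (u' := fun t => -t⁻¹) (fun t ht => ?_) fun t ht => ?_
  · refine ((Real.hasDerivAt_log ht.1.ne').neg).congr_of_eventuallyEq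
      (Filter.Eventually.of_forall fun s => ?_)
    simp
  · have ht0 := ht.1
    have h1 : Real.log (1 / t ^ 2) ≤ 1 / t ^ 2 - 1 := Real.log_le_sub_one_of_pos (by positivity)
    have h2 : Real.log (1 / t ^ 2) = 2 * Real.log (1 / t) := by
      rw [← one_div_pow, Real.log_pow]
      norm_num
    rw [h2] at h1
    have h3 : t * (2 * Real.log (1 / t)) ≤ t * (1 / t ^ 2 - 1) :=
      mul_le_mul_of_nonneg_left h1 ht0.le
    have h4 : t * (1 / t ^ 2 - 1) = t⁻¹ * (1 - t ^ 2) := by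
      field_simp
    linarith

/-- A product of three decreasing factors: `t^c`, `log(1/t)/(1 - t²)` and `log(1/t)^(p-2)`. -/
lemma antitoneOn_komatuWeight {c p : ℝ} (hc : -1 < c) (hc0 : c ≤ 0) (hp : 2 ≤ p) :
    AntitoneOn (fun t => komatuWeight c p t / (1 - t ^ 2)) (Ioo 0 1) := by
  have hK : 0 ≤ (1 + c) ^ p / Real.Gamma p :=
    div_nonneg (Real.rpow_nonneg (by linarith) p) (Real.Gamma_nonneg_of_nonneg (by linarith))
  have hlog : AntitoneOn (fun t : ℝ => Real.log (1 / t) ^ (p - 2)) (Ioo 0 1) :=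
    fun x hx y hy hxy => Real.rpow_le_rpow (log_one_div_pos hy).le
      (Real.log_le_log (by have := hy.1; positivity) (one_div_le_one_div_of_le hx.1 hxy))
      (by linarith)
  have h1 := antitoneOn_mul_of_nonneg (antitoneOn_rpow_of_nonpos hc0) antitoneOn_log_div
    (fun t ht => Real.rpow_nonneg ht.1.le _)
    fun t ht => div_nonneg (log_one_div_pos ht).le (one_sub_sq_pos ht).le
  have h2 := antitoneOn_mul_of_nonneg h1 hlog (fun t ht => mul_nonneg (Real.rpow_nonneg ht.1.le _)
    (div_nonneg (log_one_div_pos ht).le (one_sub_sq_pos ht).le))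
    fun t ht => Real.rpow_nonneg (log_one_div_pos ht).le _
  refine antitoneOn_congr (fun t ht => ?_) (fun x hx y hy hxy =>
    mul_le_mul_of_nonneg_left (h2 hx hy hxy) hK)
  have : Real.log (1 / t) ^ (p - 1) = Real.log (1 / t) * Real.log (1 / t) ^ (p - 2) := by
    rw [← Real.rpow_one_add' (log_one_div_pos ht).le (by linarith)]
    ring_nf
  simp only [komatuWeight]
  rw [this]
  ring

/-- The substitution `t = exp(-s)` turns this into a Gamma integral. -/
lemma integral_komatuWeight {c p : ℝ} (hc : -1 < c) (hp : 0 < p) :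
    ∫ t in (0 : ℝ)..1, komatuWeight c p t = 1 := by
  have himg : (fun s : ℝ => Real.exp (-s)) '' Ioi 0 = Ioo 0 1 := by
    ext t
    constructor
    · rintro ⟨s, hs, rfl⟩
      exact ⟨Real.exp_pos _, by simpa using hs⟩
    · intro ht
      exact ⟨-Real.log t, by simpa using Real.log_neg ht.1 ht.2, by
        simp [Real.exp_log ht.1]⟩
  have hsub := integral_image_eq_integral_abs_deriv_smul (measurableSet_Ioi (a := (0 : ℝ)))
    (f := fun s => Real.exp (-s)) (f' := fun s => -Real.exp (-s))
    (fun s _ => by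
      have := ((hasDerivAt_id s).neg).exp
      simp only [mul_neg, mul_one] at this
      exact this.hasDerivWithinAt)
    (fun s _ t _ h => by simpa using h) (komatuWeight c p)
  rw [intervalIntegral.integral_of_le zero_le_one, integral_Ioc_eq_integral_Ioo, ← himg, hsub]
  have e : ∀ s ∈ Ioi (0 : ℝ), |-Real.exp (-s)| • komatuWeight c p (Real.exp (-s))
      = (1 + c) ^ p / Real.Gamma p * (s ^ (p - 1) * Real.exp (-((1 + c) * s))) := fun s _ => by
    rw [abs_neg, abs_of_pos (Real.exp_pos _), smul_eq_mul, komatuWeight, ← Real.exp_mul, one_div,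
      ← Real.exp_neg, neg_neg, Real.log_exp,
      show -((1 + c) * s) = -s + -s * c by ring, Real.exp_add]
    ring
  rw [setIntegral_congr_fun measurableSet_Ioi e, integral_const_mul,
    Real.integral_rpow_mul_exp_neg_mul_Ioi hp (by linarith)]
  have hc1 : 0 < 1 + c := by linarith
  have h1 := (Real.Gamma_pos_of_pos hp).ne'
  have h2 := (Real.rpow_pos_of_pos hc1 p).ne'
  rw [Real.div_rpow zero_le_one hc1.le, Real.one_rpow]
  field_simp

lemma isWeight_komatuWeight {c p : ℝ} (hc : -1 < c) (hp : 0 < p) :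
    IsWeight (komatuWeight c p) where
  nonneg t ht := by
    have := Real.rpow_nonneg (by linarith : 0 ≤ 1 + c) p
    have := Real.Gamma_pos_of_pos hp
    have := Real.rpow_nonneg ht.1.le c
    have := Real.rpow_nonneg (log_one_div_pos ht).le (p - 1)
    unfold komatuWeight
    positivity
  -- A non-integrable function has integral 0 by convention, so the value 1 already yields
  -- integrability.
  integrable := intervalIntegral.intervalIntegrable_of_integral_ne_zero (by
    rw [integral_komatuWeight hc hp]; exact one_ne_zero)
  integral_eq_one := integral_komatuWeight hc hp

lemma abWeight_self (a : ℝ) : abWeight a a = komatuWeight a 2 := by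
  ext t
  rw [abWeight, if_pos rfl, komatuWeight, Real.Gamma_two, show (2 : ℝ) - 1 = 1 by norm_num, Real.rpow_one,
    Real.rpow_two, add_comm a 1]
  ring

lemma abWeight_eq {a b : ℝ} (hab : b ≠ a) {t : ℝ} (ht : 0 < t) :
    abWeight a b t = (a + 1) * (b + 1) / (b - a) * (t ^ a - t ^ b) := by
  rw [abWeight, if_neg hab, mul_sub (t ^ a), ← Real.rpow_add ht, mul_one]
  ring_nf

lemma integral_abWeight {a b : ℝ} (ha : -1 < a) (hb : -1 < b) (hab : b ≠ a) :
    ∫ t in (0 : ℝ)..1, abWeight a b t = 1 := by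
  rw [intervalIntegral.integral_congr_Ioo_of_le zero_le_one fun t ht => abWeight_eq hab ht.1,
    intervalIntegral.integral_const_mul, intervalIntegral.integral_sub
      (intervalIntegral.intervalIntegrable_rpow' ha)
      (intervalIntegral.intervalIntegrable_rpow' hb), integral_rpow (Or.inl ha),
    integral_rpow (Or.inl hb)]
  have h1 : a + 1 ≠ 0 := by linarith
  have h2 : b + 1 ≠ 0 := by linarith
  have h3 : b - a ≠ 0 := sub_ne_zero.mpr hab
  rw [Real.one_rpow, Real.one_rpow, Real.zero_rpow h1, Real.zero_rpow h2]
  field_simp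
  ring

lemma isWeight_abWeight {a b : ℝ} (ha : -1 < a) (hb : -1 < b) : IsWeight (abWeight a b) := by
  rcases eq_or_ne b a with rfl | hab
  · rw [abWeight_self b]
    exact isWeight_komatuWeight hb two_pos
  refine ⟨fun t ht => ?_, intervalIntegral.intervalIntegrable_of_integral_ne_zero (by
    rw [integral_abWeight ha hb hab]; exact one_ne_zero), integral_abWeight ha hb hab⟩
  rw [abWeight_eq hab ht.1, div_mul_eq_mul_div, mul_div_assoc]
  refine mul_nonneg (mul_nonneg (by linarith) (by linarith)) ?_
  rcases lt_or_gt_of_ne hab with h | h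
  · exact div_nonneg_of_nonpos (sub_nonpos.mpr
      (Real.rpow_le_rpow_of_exponent_ge ht.1 ht.2.le h.le)) (by linarith)
  · exact div_nonneg (sub_nonneg.mpr
      (Real.rpow_le_rpow_of_exponent_ge ht.1 ht.2.le h.le)) (by linarith)

lemma rpow_le_of_le_one {y θ : ℝ} (hy : 0 ≤ y) (h0 : 0 ≤ θ) (h1 : θ ≤ 1) :
    y ^ θ ≤ 1 + θ * (y - 1) := by
  have := rpow_one_add_le_one_add_mul_self (s := y - 1) (by linarith) h0 h1
  simpa using this

/-- Equality holds at `y = 1`, and the difference of the sides decreases because `m y^(m-1) ≤ 1 +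
(m-1) y^m`, which is Bernoulli for `y^m` with exponent `(m-1)/m`. -/
lemma mul_sub_rpow_le {m y : ℝ} (hm : 1 ≤ m) (hy : 0 < y) (hy1 : y ≤ 1) :
    (m + 1) * (y - y ^ m) ≤ (m - 1) * (1 - y ^ (m + 1)) := by
  set Q : ℝ → ℝ := fun y => (m - 1) * (1 - y ^ (m + 1)) - (m + 1) * (y - y ^ m)
  have hd : ∀ y, 0 < y → HasDerivAt Q
      ((m - 1) * -((m + 1) * y ^ m) - (m + 1) * (1 - m * y ^ (m - 1))) y := fun y hy => by
    have h1 := Real.hasDerivAt_rpow_const (x := y) (p := m + 1) (Or.inl hy.ne')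
    have h2 := Real.hasDerivAt_rpow_const (x := y) (p := m) (Or.inl hy.ne')
    rw [add_sub_cancel_right] at h1
    exact ((h1.const_sub 1).const_mul _).sub (((hasDerivAt_id y).sub h2).const_mul _)
  have hanti : AntitoneOn Q (Ioc 0 1) := by
    refine antitoneOn_of_deriv_nonpos (convex_Ioc 0 1)
      (fun t ht => (hd t ht.1).continuousAt.continuousWithinAt) (fun t ht => ?_) fun t ht => ?_
    · rw [interior_Ioc] at ht
      exact (hd t ht.1).differentiableAt.differentiableWithinAt
    · rw [interior_Ioc] at ht
      rw [(hd t ht.1).deriv]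
      have hm0 : 0 < m := by linarith
      have h1 := rpow_le_of_le_one (y := t ^ m) (θ := (m - 1) / m)
        (Real.rpow_nonneg ht.1.le m) (div_nonneg (by linarith) hm0.le)
        ((div_le_one hm0).mpr (by linarith))
      rw [← Real.rpow_mul ht.1.le, mul_div_cancel₀ _ hm0.ne'] at h1
      have h2 : m * t ^ (m - 1) ≤ m * (1 + (m - 1) / m * (t ^ m - 1)) :=
        mul_le_mul_of_nonneg_left h1 hm0.le
      have h3 : m * (1 + (m - 1) / m * (t ^ m - 1)) = 1 + (m - 1) * t ^ m := by
        field_simp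
        ring
      nlinarith
  have h := hanti ⟨hy, hy1⟩ ⟨one_pos, le_rfl⟩ hy1
  simp only [Q, Real.one_rpow] at h
  linarith

lemma antitoneOn_rpow_sub_rpow {a b : ℝ} (hab : a < b) (ha : a ≤ 0) (hs : a + b ≤ 2) :
    AntitoneOn (fun t : ℝ => (t ^ a - t ^ b) / (1 - t ^ 2)) (Ioo 0 1) := by
  refine antitoneOn_div_one_sub_sq (u := fun t => t ^ a - t ^ b)
    (u' := fun t => a * t ^ (a - 1) - b * t ^ (b - 1)) (fun t ht => ?_) fun t ht => ?_
  · exact (Real.hasDerivAt_rpow_const (Or.inl ht.1.ne')).sub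
      (Real.hasDerivAt_rpow_const (Or.inl ht.1.ne'))
  have ht0 := ht.1
  set m := (b - a) / 2 with hm
  have hm0 : 0 < m := by rw [hm]; linarith
  set y := t ^ 2 with hy
  have hy0 : 0 < y := by positivity
  have hy1 : y ≤ 1 := by rw [hy]; nlinarith [ht.2]
  have hYm : y ^ m = t ^ (b - a) := by
    rw [hy, ← Real.rpow_natCast t 2, ← Real.rpow_mul ht0.le, hm]
    push_cast
    ring_nf
  have hYm0 : 0 < y ^ m := Real.rpow_pos_of_pos hy0 m
  have hYm1 : y ^ m ≤ 1 := Real.rpow_le_one hy0.le hy1 hm0.le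
  have hYs : y ^ (m + 1) = y ^ m * y := by rw [Real.rpow_add hy0, Real.rpow_one]
  have hb : t ^ b = t ^ a * y ^ m := by
    rw [hYm, ← Real.rpow_add ht0]
    ring_nf
  -- This is the derivative criterion divided by `t^a / t`, in `y = t²` and `m = (b - a)/2`. For `m
  -- ≤ 1` the `a` term is dropped and Bernoulli gives `y (1 - y^m) ≤ m y^m (1 - y)`. For `m ≥ 1` the
  -- bound `a + b ≤ 2` reads `a ≤ 1 - m`, and the extreme value `a = 1 - m` is `mul_sub_rpow_le`.
  have hkey : a * ((1 - y) * (1 - y ^ m)) - 2 * m * y ^ m * (1 - y) + 2 * y * (1 - y ^ m) ≤ 0 := by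
    have hnn : 0 ≤ (1 - y) * (1 - y ^ m) := mul_nonneg (by linarith) (by linarith)
    rcases le_total m 1 with h | h
    · have h1 := rpow_le_of_le_one (θ := 1 - m) hy0.le (by linarith) (by linarith)
      have h2 : y = y ^ (1 - m) * y ^ m := by
        rw [← Real.rpow_add hy0]
        simp
      have h3 : y ≤ (1 + (1 - m) * (y - 1)) * y ^ m := by
        calc y = y ^ (1 - m) * y ^ m := h2
          _ ≤ _ := mul_le_mul_of_nonneg_right h1 hYm0.le
      nlinarith [mul_nonneg (neg_nonneg.mpr ha) hnn]
    · have h1 := mul_sub_rpow_le h hy0 hy1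
      rw [hYs] at h1
      have h2 : a ≤ 1 - m := by rw [hm]; linarith
      nlinarith [mul_nonneg (sub_nonneg.mpr h2) hnn]
  have hbm : b = a + 2 * m := by rw [hm]; ring
  have hta : 0 < t ^ a := Real.rpow_pos_of_pos ht0 a
  rw [Real.rpow_sub_one ht0.ne', Real.rpow_sub_one ht0.ne']
  have e : (a * (t ^ a / t) - b * (t ^ b / t)) * (1 - y) + 2 * t * (t ^ a - t ^ b)
      = t ^ a / t * (a * ((1 - y) * (1 - y ^ m)) - 2 * m * y ^ m * (1 - y)
        + 2 * y * (1 - y ^ m)) := by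
    rw [hb]
    have hty : t * t = y := by rw [hy]; ring
    nth_rewrite 1 [hbm]
    field_simp
    linear_combination 2 * (1 - y ^ m) * hty
  rw [e]
  exact mul_nonpos_of_nonneg_of_nonpos (by positivity) hkey

lemma antitoneOn_abWeight {a b : ℝ} (ha : -1 < a) (hab : a < b) (ha0 : a ≤ 0)
    (hs : a + b ≤ 2) :
    AntitoneOn (fun t => abWeight a b t / (1 - t ^ 2)) (Ioo 0 1) := by
  have hC : 0 ≤ (a + 1) * (b + 1) / (b - a) :=
    div_nonneg (mul_nonneg (by linarith) (by linarith)) (by linarith)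
  refine antitoneOn_congr (fun t ht => ?_) fun x hx y hy hxy =>
    mul_le_mul_of_nonneg_left (antitoneOn_rpow_sub_rpow hab ha0 hs hx hy hxy) hC
  simp only
  rw [abWeight_eq hab.ne' ht.1, mul_div_assoc]

lemma abWeight_comm {a b : ℝ} {t : ℝ} (ht : 0 < t) : abWeight a b t = abWeight b a t := by
  rcases eq_or_ne b a with rfl | hab
  · rfl
  · rw [abWeight_eq hab ht, abWeight_eq hab.symm ht, ← neg_sub a b, div_neg]
    ring

/-- The product is `k t^(B-2-1/p) (1-t)^(C-A-B) φ(1-t)`, and each of the three functions of `t`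
decreases. -/
lemma antitoneOn_hypergeometricWeight {k A B C p : ℝ} {φ : ℝ → ℝ} (hφ : IsHypergeometricFactor φ)
    (hw : IsWeight (hypergeometricWeight k A B C φ)) (hB : B ≤ 2 + 1 / p) (hC : B ≤ C - A) :
    AntitoneOn (fun t => hypergeometricWeight k A B C φ t * t ^ (-1 - 1 / p)) (Ioo 0 1) := by
  have hrefl : ∀ t ∈ Ioo (0 : ℝ) 1, 1 - t ∈ Ioo (0 : ℝ) 1 := fun t ht =>
    ⟨by linarith [ht.2], by linarith [ht.1]⟩
  -- The other factors are positive at `t = 1/2`, so non-negativity of the weight there decides the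
  -- sign of `k`.
  have hk : 0 ≤ k := by
    have hmem : (1 / 2 : ℝ) ∈ Ioo (0 : ℝ) 1 := by norm_num
    have h := hw.nonneg _ hmem
    have h1 := hφ.pos _ (hrefl _ hmem)
    have h2 : (0 : ℝ) < (1 / 2) ^ (B - 1) := by positivity
    have h3 : (0 : ℝ) < (1 - 1 / 2) ^ (C - A - B) := Real.rpow_pos_of_pos (by norm_num) _
    unfold hypergeometricWeight at h
    by_contra! hneg
    have := mul_pos (mul_pos h2 h3) h1
    nlinarith
  have hmono : MonotoneOn φ (Ioo 0 1) := by
    refine monotoneOn_of_deriv_nonneg (convex_Ioo 0 1) hφ.contDiffOn.continuousOn ?_ ?_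
    · rw [interior_Ioo]
      exact hφ.contDiffOn.differentiableOn (by norm_num)
    · rw [interior_Ioo]
      exact hφ.deriv_nonneg
  have hφa : AntitoneOn (fun t => φ (1 - t)) (Ioo 0 1) := fun x hx y hy hxy =>
    hmono (hrefl y hy) (hrefl x hx) (by linarith)
  have hpow : AntitoneOn (fun t : ℝ => (1 - t) ^ (C - A - B)) (Ioo 0 1) := fun x hx y hy hxy =>
    Real.rpow_le_rpow (hrefl y hy).1.le (by linarith) (by linarith)
  have h1 := antitoneOn_mul_of_nonneg
    (antitoneOn_rpow_of_nonpos (e := B - 1 + (-1 - 1 / p)) (by linarith)) hpow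
    (fun t ht => Real.rpow_nonneg ht.1.le _) fun t ht => Real.rpow_nonneg (hrefl t ht).1.le _
  have h2 := antitoneOn_mul_of_nonneg h1 hφa
    (fun t ht => mul_nonneg (Real.rpow_nonneg ht.1.le _) (Real.rpow_nonneg (hrefl t ht).1.le _))
    fun t ht => (hφ.pos _ (hrefl t ht)).le
  refine antitoneOn_congr (fun t ht => ?_) fun x hx y hy hxy =>
    mul_le_mul_of_nonneg_left (h2 hx hy hxy) hk
  simp only [hypergeometricWeight]
  rw [Real.rpow_add ht.1]
  ring

lemma IsWeight.hasGapProperty {lam : ℝ → ℝ} (hw : IsWeight lam)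
    (ha : AntitoneOn (fun t => lam t / (1 - t ^ 2)) (Ioo 0 1)) {p : ℝ} (hp : 0 ≤ p) :
    HasGapProperty lam p := fun _ _ hc hr hr1 =>
  integral_weight_mul_powerAvg_nonneg hw.nonneg hw.integrable ha hp hc hr hr1

end PascuClass

/-! ### The three cases -/

theorem mainTheorem11
    (α γ μ ν ξ ρ β : ℝ)
    (hγ : 0 < γ) (hμ : 1 ≤ μ) (hν : 0 ≤ ν)
    (hsum : μ + ν = α - γ) (hprod : μ * ν = γ)
    (hξ0 : 0 ≤ ξ) (hξ1 : ξ ≤ 1) (hρ : ρ < 1) (hβ : β < 1) :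
    (∀ (k A B C : ℝ) (φ : ℝ → ℝ),
      1 < μ → 1 < ν →
      PascuClass.IsHypergeometricFactor φ →
      PascuClass.IsWeight (PascuClass.hypergeometricWeight k A B C φ) →
      PascuClass.BetaCondition (PascuClass.hypergeometricWeight k A B C φ) μ ν ξ ρ β →
      B < min (2 + 1 / μ) (C - A - 1) →
      ∀ f ∈ PascuClass.classW β α γ,
        PascuClass.genOp (PascuClass.hypergeometricWeight k A B C φ) ρ f ∈ PascuClass.pascu ξ) ∧
    (∀ a b : ℝ,
      -1 < a → -1 < b →
      PascuClass.BetaCondition (PascuClass.abWeight a b) μ ν ξ ρ β →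
      ((a < b ∧ a < 0 ∧ b + a - 1 < 1 / μ ∧ 1 / μ < b - 1) ∨
        (b < a ∧ b < 0 ∧ b + a - 1 < 1 / μ ∧ 1 / μ < a - 1) ∨
        (b = a ∧ a < 0 ∧ b - 1 < 1 / μ)) →
      ∀ f ∈ PascuClass.classW β α γ,
        PascuClass.genOp (PascuClass.abWeight a b) ρ f ∈ PascuClass.pascu ξ) ∧
    (∀ c p : ℝ,
      -1 < c → c < 0 → 2 < p →
      PascuClass.BetaCondition (PascuClass.komatuWeight c p) μ ν ξ ρ β →
      ∀ f ∈ PascuClass.classW β α γ,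
        PascuClass.genOp (PascuClass.komatuWeight c p) ρ f ∈ PascuClass.pascu ξ) := by
  have hμ0 : 0 < μ := by linarith
  have hν0 : 0 < ν := lt_of_le_of_ne hν fun h => by
    rw [← h, mul_zero] at hprod
    linarith
  have hμi : 1 / μ ≤ 1 := (div_le_one hμ0).mpr hμ
  -- Here `p = ν` and `q = μ`, so that `ξ ≤ 1 ≤ μ = q`.
  have hanti : ∀ lam : ℝ → ℝ, PascuClass.IsWeight lam →
      AntitoneOn (fun t => lam t / (1 - t ^ 2)) (Ioo 0 1) →
      PascuClass.BetaCondition lam μ ν ξ ρ β →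
      ∀ f ∈ PascuClass.classW β α γ, PascuClass.genOp lam ρ f ∈ PascuClass.pascu ξ :=
    fun lam hw ha hbeta f hf => PascuClass.genOp_mem_pascu hν0 hμ0 (Or.inr ⟨rfl, rfl⟩) hsum hprod
      hξ0 (hξ1.trans hμ) hρ hβ hw hbeta (hw.hasGapProperty ha hν0.le) hf
  refine ⟨fun k A B C φ _ hν1 hφ hw hbeta hB f hf => ?_, fun a b ha hb hbeta h => ?_,
    fun c p hc hc0 hp hbeta => ?_⟩
  · obtain ⟨hB1, hB2⟩ := lt_min_iff.mp hB
    -- The roles are exchanged: the inner average must be the one over `σ^μ`, to match the exponent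
    -- `-1 - 1/μ`, and `ξ ≤ ν` comes from `ν > 1`.
    refine PascuClass.genOp_mem_pascu hμ0 hν0 (Or.inl ⟨rfl, rfl⟩) hsum hprod hξ0
      (hξ1.trans hν1.le) hρ hβ hw hbeta (fun c r hc hr hr1 => ?_) hf
    exact PascuClass.integral_weight_mul_powerAvg_nonneg' hw.nonneg hw.integrable hμ
      (PascuClass.antitoneOn_hypergeometricWeight hφ hw hB1.le (by linarith)) hc hr hr1
  · refine hanti _ (PascuClass.isWeight_abWeight ha hb) ?_ hbeta
    -- In the first two cases `a + b < 1 + 1/μ ≤ 2`; for `b = a` the weight is the Komatu weight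
    -- with exponent 2.
    rcases h with ⟨hab, ha0, hs, -⟩ | ⟨hab, hb0, hs, -⟩ | ⟨rfl, ha0, -⟩
    · exact PascuClass.antitoneOn_abWeight ha hab ha0.le (by linarith)
    · refine PascuClass.antitoneOn_congr (fun t ht => ?_)
        (PascuClass.antitoneOn_abWeight hb hab hb0.le (by linarith))
      rw [PascuClass.abWeight_comm ht.1]
    · rw [PascuClass.abWeight_self b]
      exact PascuClass.antitoneOn_komatuWeight hb ha0.le le_rfl
  · exact hanti _ (PascuClass.isWeight_komatuWeight hc (by linarith))
      (PascuClass.antitoneOn_komatuWeight hc hc0.le hp.le) hbeta
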